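/- **Characterization of initialization-free noiseless subsystems.** Let $\mathcal H=\mathbb C^n$ be a finite-dimensional Hilbert space and let $\mathcal E(\rho)=\sum_i K_i\rho K_i^\dagger$, with $\sum_iK_i^\dagger K_i=1$, be a quantum channel on $\mathcal B(\mathcal H)$, with adjoint $\mathcal E^\dagger(X)=\sum_iK_i^\dagger XK_i$. Let $P_0$ be the orthogonal projection onto the support $\mathcal P_0$ of the fixed points of $\mathcal E$ (the span of the ranges of all $X$ with $\mathcal E(X)=X$), and let $\mathcal P_0=\bigoplus_k A_k\otimes B_k$ be its canonical decomposition into sectors, i.e. the orthogonal decomposition for which $$\{X: P_0XP_0=X,\ P_0\mathcal E^\dagger(X)P_0=X\}=\Big\{\sum_k Y_k\otimes 1_{B_k}: Y_k\in\mathcal B(A_k)\Big\}.$$ Fix a sector $\mathcal P_k=A_k\otimes B_k$ with orthogonal projection $P_k$. Definitions. States are positive semidefinite operators of trace $1$; a code is a set of states. * A code $\mathcal C$ is *preserved* by a map $\mathcal F$ if $\|\mathcal F(p\rho-(1-p)\sigma)\|_1=\|p\rho-(1-p)\sigma\|_1$ for all $\rho,\sigma\in\mathcal C$ and $p\in[0,1]$,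 where $\|M\|_1=\operatorname{tr}\sqrt{M^\dagger M}$. It is *noiseless* for $\mathcal E$ if it is preserved by every convex combination $\sum_m q_m\mathcal E^m$ of powers of $\mathcal E$. * $\mathcal C$ is *unconditionally preserved* by $\mathcal E$ if for all $\rho,\sigma$ in the convex hull of $\mathcal C$ and all $p\in[0,1]$ the Helstrom measurement $\{\Pi_+,\Pi_0,\Pi_-\}$ of $\Delta=p\rho-(1-p)\sigma$ (the spectral projections of $\Delta$ on $(0,\infty)$, $\{0\}$, $(-\infty,0)$) is reproduced after the channel: there is a measurement $\{Q_+,Q_0,Q_-\}$ ($Q_x\ge0$, $\sum_xQ_x=1$) with $\operatorname{Tr}[\Pi_x\omega]=\operatorname{Tr}[Q_x\mathcal E(\omega)]$ for all states $\omega$ on $\mathcal H$ and all $x$. * For a subspace $S=A\otimes B$ of $\mathcal H$ with orthogonal projection $P$, the factor $A$ is *initialization-free* (IF) if $\operatorname{tr}_B[P\mathcal E(\rho)P]=\operatorname{tr}_B[P\rho P]$ for every state $\rho$ on $\mathcal H$, including those not supported on $S$. * For a state $\tau$ on $B$, $\mathcal C_\tau=\{\rho_A\otimes\tau:\rho_A\text{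 a state on }A\}$, viewed as a code on $\mathcal H$. Then: 1. Let $\tau$ be a state on $B_k$ such that all states $\rho_{A_k}\otimes\tau$ are fixed by $\mathcal E$. The noiseless subsystem $A_k$ is initialization-free if and only if its code $\mathcal C_\tau$ is both noiseless and unconditionally preserved. 2. More generally, let $\mathcal P_k=A\otimes B$ be any tensor factorization of the sector and $\tau$ any state of full rank on $B$. Then $A$ is initialization-free if and only if $\mathcal C_\tau$ is both noiseless and unconditionally preserved. 3. Let $A_i=P_kK_iP_0$ and $D_i=P_kK_i(1-P_0)$ (the blocks of $K_i$ mapping $\mathcal P_0$, respectively its orthogonal complement, into $\mathcal P_k$). The subsystem $A_k$ is initialization-free if and only if the interference terms $$\sum_iD_i\rho D_i^\dagger+\sum_i\big(A_i\rho D_i^\dagger+D_i\rho A_i^\dagger\big)$$ vanish for every state $\rho$ on $\mathcal H$; and they vanish for every state $\rho$ if and only if $D_i=0$ for all $i$. -/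

import Mathlib

open scoped Matrix Kronecker ComplexOrder

namespace NoiselessSubsystem

noncomputable section

/-- The quantum channel `ρ ↦ ∑ i, K i * ρ * (K i)ᴴ` with Kraus operators `K i`. It is completely
positive, and it is trace preserving as soon as `∑ i, (K i)ᴴ * K i = 1`. -/
def channel {n ι : Type*} [Fintype n] [Fintype ι] (K : ι → Matrix n n ℂ) :
    Matrix n n ℂ →ₗ[ℂ] Matrix n n ℂ where
  toFun ρ := ∑ i, K i * ρ * (K i)ᴴ
  map_add' ρ σ := by simp [Matrix.mul_add, Matrix.add_mul, Finset.sum_add_distrib]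
  map_smul' c ρ := by simp [Finset.smul_sum]

/-- The adjoint (Heisenberg picture) map `X ↦ ∑ i, (K i)ᴴ * X * K i` of `channel K`. -/
def dualChannel {n ι : Type*} [Fintype n] [Fintype ι] (K : ι → Matrix n n ℂ) :
    Matrix n n ℂ →ₗ[ℂ] Matrix n n ℂ :=
  channel fun i => (K i)ᴴ

/-- Density matrices (states). -/
def IsDensity {n : Type*} [Fintype n] (ρ : Matrix n n ℂ) : Prop :=
  ρ.PosSemidef ∧ ρ.trace = 1

/-- The partial trace `tr_B` over the second tensor factor. -/
def partialTrace {α β : Type*} [Fintype β] (M : Matrix (α × β) (α × β) ℂ) : Matrix α α ℂ :=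
  Matrix.of fun i j => ∑ k, M (i, k) (j, k)

/-- The trace norm `‖M‖₁ = tr √(Mᴴ M)`. -/
def traceNorm {n : Type*} [Fintype n] [DecidableEq n] (M : Matrix n n ℂ) : ℝ :=
  (cfc Real.sqrt (Mᴴ * M)).trace.re

/-! ### Codes: preservation, noiselessness, unconditional preservation -/

/-- A code (a set of states) is preserved by `E` if `E` does not change the trace norm of any
weighted difference of code states. -/
def IsPreserved {n : Type*} [Fintype n] [DecidableEq n] (E : Matrix n n ℂ →ₗ[ℂ] Matrix n n ℂ)
    (C : Set (Matrix n n ℂ)) : Prop :=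
  ∀ ρ ∈ C, ∀ σ ∈ C, ∀ p : ℝ, 0 ≤ p → p ≤ 1 →
    traceNorm (E ((p : ℂ) • ρ - ((1 - p : ℝ) : ℂ) • σ)) =
      traceNorm ((p : ℂ) • ρ - ((1 - p : ℝ) : ℂ) • σ)

/-- A code is noiseless for `E` if it is preserved by every convex combination of powers
of `E`. -/
def IsNoiseless {n : Type*} [Fintype n] [DecidableEq n] (E : Matrix n n ℂ →ₗ[ℂ] Matrix n n ℂ)
    (C : Set (Matrix n n ℂ)) : Prop :=
  ∀ (s : Finset ℕ) (q : ℕ → ℝ), (∀ m ∈ s, 0 ≤ q m) → ∑ m ∈ s, q m = 1 →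
    IsPreserved (∑ m ∈ s, (q m : ℂ) • E ^ m) C

/-- A measurement `M` on the input is unconditionally preserved by `E` if some measurement `Q` on
the output reproduces its statistics on all input states. -/
def IsMeasurementPreserved {n κ : Type*} [Fintype n] [DecidableEq n] [Fintype κ]
    (E : Matrix n n ℂ →ₗ[ℂ] Matrix n n ℂ) (M : κ → Matrix n n ℂ) : Prop :=
  ∃ Q : κ → Matrix n n ℂ, (∀ x, (Q x).PosSemidef) ∧ ∑ x, Q x = 1 ∧
    ∀ ρ, IsDensity ρ → ∀ x, (M x * ρ).trace = (Q x * E ρ).trace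

/-- The Helstrom measurement of a Hermitian weighted difference `Δ`: it measures the sign of the
observable `Δ`, with the outcomes `1`, `0`, `-1` given by the spectral projections of `Δ` on
`(0, ∞)`, `{0}`, `(-∞, 0)`. -/
def helstrom {n : Type*} [Fintype n] [DecidableEq n] (Δ : Matrix n n ℂ) :
    SignType → Matrix n n ℂ :=
  fun s => cfc (fun x : ℝ => if SignType.sign x = s then (1 : ℝ) else 0) Δ

/-- A code is unconditionally preserved by `E` if the Helstrom measurement of every weighted pair
of states in its convex hull is. -/
def IsUnconditionallyPreserved {n : Type*} [Fintype n] [DecidableEq n]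
    (E : Matrix n n ℂ →ₗ[ℂ] Matrix n n ℂ) (C : Set (Matrix n n ℂ)) : Prop :=
  ∀ ρ ∈ convexHull ℝ C, ∀ σ ∈ convexHull ℝ C, ∀ p : ℝ, 0 ≤ p → p ≤ 1 →
    IsMeasurementPreserved E (helstrom ((p : ℂ) • ρ - ((1 - p : ℝ) : ℂ) • σ))

/-! ### Subsystems

A subsystem of `H = ℂⁿ`, i.e. a decomposition `H = (A ⊗ B) ⊕ C`, is given by an isometry
`W : A ⊗ B → H`, a matrix with `Wᴴ * W = 1`; the projection on `A ⊗ B` is `W * Wᴴ`, and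
the `A ⊗ B` block of `ρ` is `Wᴴ * ρ * W`. -/

/-- The code `{ρ_A ⊗ τ : ρ_A a state on A}` carried by the subsystem. -/
def subsystemCode {n α β : Type*} [Fintype α] [Fintype β]
    (W : Matrix n (α × β) ℂ) (τ : Matrix β β ℂ) : Set (Matrix n n ℂ) :=
  {ρ | ∃ ρA : Matrix α α ℂ, IsDensity ρA ∧ ρ = W * (ρA ⊗ₖ τ) * Wᴴ}

/-- The factor `A` is initialization-free: for every state `ρ` of the whole system, perfectly
initialized or not, the (subnormalized) blocks on `A ⊗ B` before and after the channel
have the same reduced state on `A`. -/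
def IsInitializationFree {n α β : Type*} [Fintype n] [Fintype α] [Fintype β]
    (E : Matrix n n ℂ →ₗ[ℂ] Matrix n n ℂ) (W : Matrix n (α × β) ℂ) : Prop :=
  ∀ ρ, IsDensity ρ → partialTrace (Wᴴ * E ρ * W) = partialTrace (Wᴴ * ρ * W)

/-! ### The fixed-point structure of a channel -/

/-- The support of the fixed points of `E`: the span of the ranges of all fixed operators. -/
def fixedSupport {n : Type*} [Fintype n] (E : Matrix n n ℂ →ₗ[ℂ] Matrix n n ℂ) :
    Submodule ℂ (n → ℂ) :=
  ⨆ X ∈ {X : Matrix n n ℂ | E X = X}, LinearMap.range X.mulVecLin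

/-- The projection `∑ k, V k * (V k)ᴴ` on the direct sum of the orthogonal ranges of a finite
family of isometries. -/
def totalProj {n κ : Type*} [Fintype κ] {a b : κ → Type*} [∀ k, Fintype (a k)]
    [∀ k, Fintype (b k)] (V : ∀ k, Matrix n (a k × b k) ℂ) : Matrix n n ℂ :=
  ∑ k, V k * (V k)ᴴ

/-- The family `V` is the canonical decomposition `P₀ = ⨁ k, A_k ⊗ B_k` of the support `P₀` of the
fixed points of `channel K` into sectors: the fixed points of the adjoint of the channel restricted
to `P₀` are exactly the algebra `⨁ k, M(A_k) ⊗ 1`. -/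
structure IsSectorDecomposition {n ι κ : Type*} [Fintype n] [DecidableEq n] [Fintype ι]
    [Fintype κ] {a b : κ → Type*} [∀ k, Fintype (a k)] [∀ k, DecidableEq (a k)]
    [∀ k, Fintype (b k)] [∀ k, DecidableEq (b k)]
    (K : ι → Matrix n n ℂ) (V : ∀ k, Matrix n (a k × b k) ℂ) : Prop where
  isometry : ∀ k, (V k)ᴴ * V k = 1
  orthogonal : ∀ k l, k ≠ l → (V k)ᴴ * V l = 0
  support : LinearMap.range (totalProj V).mulVecLin = fixedSupport (channel K)
  algebra : ∀ X : Matrix n n ℂ,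
    (totalProj V * X * totalProj V = X ∧ totalProj V * dualChannel K X * totalProj V = X) ↔
      ∃ Y : ∀ k, Matrix (a k) (a k) ℂ,
        X = ∑ k, V k * (Y k ⊗ₖ (1 : Matrix (b k) (b k) ℂ)) * (V k)ᴴ

/-- With `A_i = P * K i * P₀` and `D_i = P * K i * (1 - P₀)`, the part
`∑ D_i ρ D_iᴴ + ∑ (A_i ρ D_iᴴ + D_i ρ A_iᴴ)` of the output block `P * channel K ρ * P` which is
caused by faulty initialization outside `P₀`. -/
def interference {n ι : Type*} [Fintype n] [DecidableEq n] [Fintype ι]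
    (K : ι → Matrix n n ℂ) (P P₀ ρ : Matrix n n ℂ) : Matrix n n ℂ :=
  ∑ i, (P * K i * (1 - P₀)) * ρ * (P * K i * (1 - P₀))ᴴ +
    ∑ i, ((P * K i * P₀) * ρ * (P * K i * (1 - P₀))ᴴ +
      (P * K i * (1 - P₀)) * ρ * (P * K i * P₀)ᴴ)

end

end NoiselessSubsystem

/-! Everything is moved to the Heisenberg picture. Write `E†` for the dual channel and `P = W * Wᴴ`.
Testing the partial traces against all `Y` shows that `A` is initialization-free iff every `Y ⊗ 1`
is fixed by `E†` (`isInitializationFree_iff`).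

If all `Y ⊗ 1` are fixed, the sign observable of a weighted difference `δ ⊗ τ` keeps its expectation
under every power of `E`; trace-norm contraction supplies the other inequality, so the code is
noiseless. For `τ` of full rank the sign of `δ ⊗ τ` is the sign of `δ`, tensored with `1`
(`cfc_place`), so the Helstrom effects are themselves fixed by `E†` and measure themselves after the
channel.

Conversely, unconditional preservation applied to a single code state gives an effect `Q` with
`E†(Q) = P`. Since `P` is the support of a fixed state, this forces every Kraus operator to commute
with `P` (`kraus_comm_of_dualChannel_eq`), whence `E†(P * X) = P * E†(X)`. Noiselessness under `(id
+ E) / 2`, applied to the normalized projections `F` and `1 - F`, gives one `Z` that is optimal both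
before and after the channel (`exists_sign_of_traceNorm_average`). Both `P * Z` and `P * E†(Z)` then
equal `(2F - 1) ⊗ 1`, so `F ⊗ 1` is fixed, and projections span all matrices.

For the fixed code of part 1, `τ` is shown to have full rank: its support projection `S` gives a
fixed point `1 ⊗ S` of the compressed dual map, which the sector algebra allows only for scalar `S`.
For part 3, `E†(P) = P` forces `D_i = 0`; conversely `D_i = 0` removes the difference between `E†`
and its compression to `P₀` on `Y ⊗ 1`. Evaluating the interference at `ρ = 1` leaves only `∑ D_i
D_iᴴ`. -/

namespace NoiselessSubsystem

/-! ### Functional calculus, positivity and trace-norm duality. -/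

section LinearAlgebra

set_option linter.unusedSectionVars false

variable {n m : Type*} [Fintype n] [DecidableEq n] [Fintype m] [DecidableEq m]

/-- The functional calculus of a Hermitian matrix respects diagonalizing intertwiners. -/
theorem cfc_mul_of_mul_eq_mul_diagonal {M : Matrix n n ℂ} (hM : M.IsHermitian)
    {X : Matrix n m ℂ} {d : m → ℝ} (h : M * X = X * Matrix.diagonal fun j => (d j : ℂ))
    (f : ℝ → ℝ) : cfc f M * X = X * Matrix.diagonal fun j => (f (d j) : ℂ) := by
  set U : Matrix n n ℂ := (hM.eigenvectorUnitary : Matrix n n ℂ) with hU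
  have hUU : U * star U = 1 := Unitary.coe_mul_star_self _
  have hUU' : star U * U = 1 := Unitary.coe_star_mul_self _
  have key : ∀ g : ℝ → ℝ, hM.cfc g =
      U * Matrix.diagonal (fun i => (g (hM.eigenvalues i) : ℂ)) * star U := by
    intro g
    simp [Matrix.IsHermitian.cfc, Unitary.conjStarAlgAut_apply, hU, Function.comp_def]
  have hM' : M = U * Matrix.diagonal (fun i => (hM.eigenvalues i : ℂ)) * star U := by
    conv_lhs => rw [hM.spectral_theorem]
    simp [Unitary.conjStarAlgAut_apply, hU, Function.comp_def]
  set C := star U * X with hC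
  have hX : X = U * C := by rw [hC, ← Matrix.mul_assoc, hUU, Matrix.one_mul]
  have h1 : Matrix.diagonal (fun i => (hM.eigenvalues i : ℂ)) * C =
      C * Matrix.diagonal fun j => (d j : ℂ) := by
    calc Matrix.diagonal (fun i => (hM.eigenvalues i : ℂ)) * C
        = (star U * U) * Matrix.diagonal (fun i => (hM.eigenvalues i : ℂ)) * C := by
          rw [hUU', Matrix.one_mul]
      _ = star U * (M * X) := by
          rw [hC]
          conv_rhs => enter [2, 1]; rw [hM']
          simp only [Matrix.mul_assoc]
      _ = _ := by rw [h, hC, Matrix.mul_assoc]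
  have h2 : Matrix.diagonal (fun i => (f (hM.eigenvalues i) : ℂ)) * C =
      C * Matrix.diagonal fun j => (f (d j) : ℂ) := by
    ext i j
    have := congrFun (congrFun h1 i) j
    rw [Matrix.diagonal_mul, Matrix.mul_diagonal] at this ⊢
    -- A nonzero entry of `C` forces the two eigenvalues to agree, hence also their images under
    -- `f`.
    by_cases hc : C i j = 0
    · simp [hc]
    · rw [mul_comm] at this
      have := mul_left_cancel₀ hc this
      rw [Complex.ofReal_inj.mp this, mul_comm]
  rw [hM.cfc_eq, key, Matrix.mul_assoc, ← hC, Matrix.mul_assoc, h2, ← Matrix.mul_assoc, ← hX]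

theorem exists_diagonalization {M : Matrix n n ℂ} (hM : M.IsHermitian) :
    ∃ (U : Matrix n n ℂ) (d : n → ℝ), U * Uᴴ = 1 ∧ Uᴴ * U = 1 ∧
      M * U = U * Matrix.diagonal (fun i => (d i : ℂ)) ∧
      ∀ f : ℝ → ℝ, cfc f M * U = U * Matrix.diagonal (fun i => (f (d i) : ℂ)) := by
  have hU : (hM.eigenvectorUnitary : Matrix n n ℂ) * (hM.eigenvectorUnitary : Matrix n n ℂ)ᴴ = 1 :=
    Unitary.coe_mul_star_self _
  have hU' : (hM.eigenvectorUnitary : Matrix n n ℂ)ᴴ * (hM.eigenvectorUnitary : Matrix n n ℂ) = 1 :=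
    Unitary.coe_star_mul_self _
  have h : M * (hM.eigenvectorUnitary : Matrix n n ℂ) = (hM.eigenvectorUnitary : Matrix n n ℂ) *
      Matrix.diagonal (fun i => (hM.eigenvalues i : ℂ)) := by
    conv_lhs => enter [1]; rw [hM.spectral_theorem]
    rw [Unitary.conjStarAlgAut_apply, Matrix.mul_assoc, Matrix.star_eq_conjTranspose, hU',
      Matrix.mul_one]
    rfl
  exact ⟨_, _, hU, hU', h, cfc_mul_of_mul_eq_mul_diagonal hM h⟩

theorem exists_eq_conj_diagonal {M : Matrix n n ℂ} (hM : M.IsHermitian) :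
    ∃ (U : Matrix n n ℂ) (d : n → ℝ), U * Uᴴ = 1 ∧ Uᴴ * U = 1 ∧
      M = U * Matrix.diagonal (fun i => (d i : ℂ)) * Uᴴ := by
  obtain ⟨U, d, h1, h2, h3, -⟩ := exists_diagonalization hM
  exact ⟨U, d, h1, h2, by rw [← h3, Matrix.mul_assoc, h1, Matrix.mul_one]⟩

theorem cfc_sqrt_mul_self {S : Matrix n n ℂ} (hS : S.PosSemidef) :
    cfc Real.sqrt (S * S) = S := by
  obtain ⟨U, d, h1, h2, h3⟩ := exists_eq_conj_diagonal hS.1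
  have hd : ∀ i, 0 ≤ d i := by
    have := hS.conjTranspose_mul_mul_same U
    rw [h3, ← Matrix.mul_assoc, ← Matrix.mul_assoc, h2, Matrix.one_mul, Matrix.mul_assoc, h2,
      Matrix.mul_one] at this
    intro i
    have := this.diag_nonneg (i := i)
    simpa using this
  have h4 : S * U = U * Matrix.diagonal (fun i => (d i : ℂ)) := by
    rw [h3, Matrix.mul_assoc, h2, Matrix.mul_one]
  have h5 : (S * S) * U = U * Matrix.diagonal (fun i => ((d i * d i : ℝ) : ℂ)) := by
    rw [Matrix.mul_assoc, h4, ← Matrix.mul_assoc, h4, Matrix.mul_assoc, Matrix.diagonal_mul_diagonal]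
    simp
  have hSS : (S * S).IsHermitian := by
    have := Matrix.isHermitian_conjTranspose_mul_self S
    rwa [hS.1.eq] at this
  have h6 := cfc_mul_of_mul_eq_mul_diagonal hSS h5 Real.sqrt
  simp only [Real.sqrt_mul_self (hd _)] at h6
  rw [← h4] at h6
  have := congrArg (· * Uᴴ) h6
  simpa only [Matrix.mul_assoc, h1, Matrix.mul_one] using this

theorem PosSemidef.exists_eq_conjTranspose_mul {A : Matrix n n ℂ} (hA : A.PosSemidef) :
    ∃ C : Matrix n n ℂ, A = Cᴴ * C := by
  open scoped MatrixOrder in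
  obtain ⟨C, hC⟩ := CStarAlgebra.nonneg_iff_eq_star_mul_self.mp (Matrix.nonneg_iff_posSemidef.mpr hA)
  exact ⟨C, hC⟩

theorem PosSemidef.trace_mul_nonneg {A B : Matrix n n ℂ} (hA : A.PosSemidef) (hB : B.PosSemidef) :
    0 ≤ (A * B).trace := by
  obtain ⟨C, rfl⟩ := PosSemidef.exists_eq_conjTranspose_mul hA
  rw [Matrix.mul_assoc, Matrix.trace_mul_comm]
  exact (hB.mul_mul_conjTranspose_same C).trace_nonneg

/-- With `A = Cᴴ * C` and `B = Dᴴ * D`, the trace is the squared Hilbert–Schmidt norm of `C * Dᴴ`.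
-/
theorem PosSemidef.mul_eq_zero_of_trace {A B : Matrix n n ℂ} (hA : A.PosSemidef)
    (hB : B.PosSemidef) (h : (A * B).trace = 0) : A * B = 0 := by
  obtain ⟨C, rfl⟩ := PosSemidef.exists_eq_conjTranspose_mul hA
  obtain ⟨D, rfl⟩ := PosSemidef.exists_eq_conjTranspose_mul hB
  have h1 : ((C * Dᴴ)ᴴ * (C * Dᴴ)).trace = 0 := by
    rw [← h, Matrix.conjTranspose_mul, Matrix.conjTranspose_conjTranspose, Matrix.mul_assoc,
      Matrix.trace_mul_comm]
    simp only [Matrix.mul_assoc]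
  have h2 := Matrix.trace_conjTranspose_mul_self_eq_zero_iff.mp h1
  rw [show Cᴴ * C * (Dᴴ * D) = Cᴴ * (C * Dᴴ) * D by simp only [Matrix.mul_assoc], h2]
  simp

theorem PosSemidef.mul_eq_zero_of_conj {A : Matrix n n ℂ} (hA : A.PosSemidef) {X : Matrix n m ℂ}
    (h : Xᴴ * A * X = 0) : A * X = 0 := by
  obtain ⟨C, rfl⟩ := PosSemidef.exists_eq_conjTranspose_mul hA
  have : (C * X)ᴴ * (C * X) = 0 := by
    rw [← h, Matrix.conjTranspose_mul]; simp only [Matrix.mul_assoc]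
  rw [Matrix.mul_assoc, Matrix.conjTranspose_mul_self_eq_zero.mp this, Matrix.mul_zero]

theorem eq_zero_of_sum_conjTranspose_mul_self {ι : Type*} [Fintype ι] {M : ι → Matrix n m ℂ}
    (h : ∑ i, (M i)ᴴ * M i = 0) (i : ι) : M i = 0 := by
  have h1 : ∑ i, ((M i)ᴴ * M i).trace = 0 := by rw [← Matrix.trace_sum, h, Matrix.trace_zero]
  have h2 := (Finset.sum_eq_zero_iff_of_nonneg
    (fun i _ => (Matrix.posSemidef_conjTranspose_mul_self (M i)).trace_nonneg)).mp h1
  exact Matrix.trace_conjTranspose_mul_self_eq_zero_iff.mp (h2 i (Finset.mem_univ i))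

/-- The Jordan decomposition, with a projection that separates the two parts. -/
theorem exists_jordan {M : Matrix n n ℂ} (hM : M.IsHermitian) :
    ∃ A B R : Matrix n n ℂ, A.PosSemidef ∧ B.PosSemidef ∧ R.IsHermitian ∧ R * R = R ∧
      M = A - B ∧ R * A = A ∧ R * B = 0 := by
  obtain ⟨U, d, h1, h2, h3⟩ := exists_eq_conj_diagonal hM
  have hmul : ∀ X Y : Matrix n n ℂ, (U * X * Uᴴ) * (U * Y * Uᴴ) = U * (X * Y) * Uᴴ := by
    intro X Y
    rw [show (U * X * Uᴴ) * (U * Y * Uᴴ) = U * X * (Uᴴ * U) * Y * Uᴴ by simp only [Matrix.mul_assoc],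
      h2, Matrix.mul_one]
    simp only [Matrix.mul_assoc]
  refine ⟨U * Matrix.diagonal (fun i => ((max (d i) 0 : ℝ) : ℂ)) * Uᴴ,
    U * Matrix.diagonal (fun i => ((max (-d i) 0 : ℝ) : ℂ)) * Uᴴ,
    U * Matrix.diagonal (fun i => if 0 < d i then 1 else 0) * Uᴴ, ?_, ?_, ?_, ?_, ?_, ?_, ?_⟩
  · refine (Matrix.PosSemidef.diagonal ?_).mul_mul_conjTranspose_same U
    intro i; simp only [Pi.zero_apply, Complex.zero_le_real]; exact le_max_right _ _
  · refine (Matrix.PosSemidef.diagonal ?_).mul_mul_conjTranspose_same U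
    intro i; simp only [Pi.zero_apply, Complex.zero_le_real]; exact le_max_right _ _
  · refine ((Matrix.PosSemidef.diagonal ?_).mul_mul_conjTranspose_same U).1
    intro i; simp only [Pi.zero_apply]; split_ifs <;> simp
  · rw [hmul, Matrix.diagonal_mul_diagonal]
    congr 3; ext i; split_ifs <;> simp
  · rw [h3, ← Matrix.sub_mul, ← Matrix.mul_sub, Matrix.diagonal_sub]
    congr 3; ext i
    rw [← Complex.ofReal_sub, max_zero_sub_max_neg_zero_eq_self]
  · rw [hmul, Matrix.diagonal_mul_diagonal]
    congr 3; ext i; split_ifs with h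
    · simp
    · simp [not_lt.mp h]
  · rw [hmul, Matrix.diagonal_mul_diagonal]
    have : (fun i => (if 0 < d i then (1 : ℂ) else 0) * ((max (-d i) 0 : ℝ) : ℂ)) = fun _ => 0 := by
      ext i; split_ifs with h
      · rw [max_eq_right (by linarith)]; simp
      · simp
    rw [this]; simp

/-- The support projection of a Hermitian matrix. -/
theorem exists_support_proj {M : Matrix n n ℂ} (hM : M.IsHermitian) :
    ∃ S N : Matrix n n ℂ, S.IsHermitian ∧ S * S = S ∧ S * M = M ∧ M * N = S := by
  obtain ⟨U, d, h1, h2, h3⟩ := exists_eq_conj_diagonal hM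
  have hmul : ∀ X Y : Matrix n n ℂ, (U * X * Uᴴ) * (U * Y * Uᴴ) = U * (X * Y) * Uᴴ := by
    intro X Y
    rw [show (U * X * Uᴴ) * (U * Y * Uᴴ) = U * X * (Uᴴ * U) * Y * Uᴴ by simp only [Matrix.mul_assoc],
      h2, Matrix.mul_one]
    simp only [Matrix.mul_assoc]
  refine ⟨U * Matrix.diagonal (fun i => if d i = 0 then 0 else 1) * Uᴴ,
    U * Matrix.diagonal (fun i => (d i : ℂ)⁻¹) * Uᴴ, ?_, ?_, ?_, ?_⟩
  · refine ((Matrix.PosSemidef.diagonal ?_).mul_mul_conjTranspose_same U).1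
    intro i; simp only [Pi.zero_apply]; split_ifs <;> simp
  · rw [hmul, Matrix.diagonal_mul_diagonal]
    congr 3; ext i; split_ifs <;> simp
  · rw [h3, hmul, Matrix.diagonal_mul_diagonal]
    congr 3; ext i; split_ifs with h <;> simp [h]
  · rw [h3, hmul, Matrix.diagonal_mul_diagonal]
    congr 3; ext i; split_ifs with h <;> simp [h]

theorem linearMap_eq_zero_of_isHermitian {E : Type*} [AddCommGroup E] [Module ℂ E]
    (L : Matrix n n ℂ →ₗ[ℂ] E) (h : ∀ M : Matrix n n ℂ, M.IsHermitian → L M = 0) : L = 0 := by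
  ext1 M
  have h1 := h (M + Mᴴ) (by simp [Matrix.IsHermitian, add_comm])
  have h2 := h (Complex.I • (M - Mᴴ)) (by
    simp [Matrix.IsHermitian, Matrix.conjTranspose_smul, smul_sub, neg_add_eq_sub])
  rw [map_smul, smul_eq_zero_iff_right Complex.I_ne_zero] at h2
  have : (2 : ℂ) • L M = 0 := by
    rw [← map_smul, show (2 : ℂ) • M = (M + Mᴴ) + (M - Mᴴ) by rw [two_smul]; abel, map_add, h1, h2,
      add_zero]
  simpa using this

/-- By the spectral theorem the projections span the Hermitian matrices, which span everything over
`ℂ`. -/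
theorem linearMap_eq_zero_of_proj {E : Type*} [AddCommGroup E] [Module ℂ E]
    (L : Matrix n n ℂ →ₗ[ℂ] E) (h : ∀ F : Matrix n n ℂ, F.IsHermitian → F * F = F → L F = 0) :
    L = 0 := by
  refine linearMap_eq_zero_of_isHermitian L fun M hM => ?_
  obtain ⟨U, d, -, h2, h3⟩ := exists_eq_conj_diagonal hM
  have : M = ∑ i, (d i : ℂ) • (U * Matrix.diagonal (Pi.single i 1) * Uᴴ) := by
    rw [h3]
    have : Matrix.diagonal (fun i => (d i : ℂ)) =
        ∑ i, (d i : ℂ) • (Matrix.diagonal (Pi.single i 1) : Matrix n n ℂ) := by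
      ext i j
      by_cases hij : i = j
      · subst hij
        simp [Matrix.sum_apply, Pi.single_apply]
      · simp [Matrix.sum_apply, hij]
    rw [this, Matrix.mul_sum, Matrix.sum_mul]
    simp
  rw [this, map_sum]
  refine Finset.sum_eq_zero fun i _ => ?_
  rw [map_smul, h, smul_zero]
  · simp only [Matrix.IsHermitian, Matrix.conjTranspose_mul, Matrix.conjTranspose_conjTranspose,
      Matrix.diagonal_conjTranspose, Matrix.mul_assoc]
    congr 3; ext j; by_cases hj : j = i <;> simp [hj]
  · rw [show ∀ X : Matrix n n ℂ, (U * X * Uᴴ) * (U * X * Uᴴ) = U * (X * (Uᴴ * U) * X) * Uᴴ by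
      intro X; simp only [Matrix.mul_assoc], h2, Matrix.mul_one, Matrix.diagonal_mul_diagonal]
    congr 3; ext j; by_cases hj : j = i <;> simp [hj]

theorem posSemidef_of_proj {F : Matrix n n ℂ} (hF : F.IsHermitian) (hF2 : F * F = F) :
    F.PosSemidef := by
  have := Matrix.posSemidef_conjTranspose_mul_self F
  rwa [hF.eq, hF2] at this

theorem isDensity_of_trace_ne_zero {F : Matrix n n ℂ} (hF : F.PosSemidef) (h : F.trace ≠ 0) :
    IsDensity ((F.trace)⁻¹ • F) := by
  refine ⟨hF.smul ?_, ?_⟩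
  · have h0 := hF.trace_nonneg
    exact inv_nonneg.mpr h0
  · simp [h]

theorem linearMap_eq_zero_of_isDensity {E : Type*} [AddCommGroup E] [Module ℂ E]
    (L : Matrix n n ℂ →ₗ[ℂ] E) (h : ∀ ρ : Matrix n n ℂ, IsDensity ρ → L ρ = 0) : L = 0 := by
  refine linearMap_eq_zero_of_proj L fun F hF hF2 => ?_
  have hp := posSemidef_of_proj hF hF2
  by_cases ht : F.trace = 0
  · rw [hp.trace_eq_zero_iff.mp ht, map_zero]
  · have := h _ (isDensity_of_trace_ne_zero hp ht)
    rwa [map_smul, smul_eq_zero_iff_right (inv_ne_zero ht)] at this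

theorem eq_of_trace_mul_eq_of_isDensity {M N : Matrix n n ℂ}
    (h : ∀ ρ, IsDensity ρ → (M * ρ).trace = (N * ρ).trace) : M = N := by
  have := linearMap_eq_zero_of_isDensity
    ((Matrix.traceLinearMap n ℂ ℂ).comp (LinearMap.mulLeft ℂ (M - N))) (fun ρ hρ => by
      simp [Matrix.sub_mul, h ρ hρ])
  rw [Matrix.ext_iff_trace_mul_right]
  intro X
  have := LinearMap.congr_fun this X
  simpa [Matrix.sub_mul, sub_eq_zero] using this

/-! ### The trace norm -/

theorem traceNorm_sub {A B : Matrix n n ℂ} (hA : A.PosSemidef) (hB : B.PosSemidef)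
    (hAB : A * B = 0) : traceNorm (A - B) = (A.trace + B.trace).re := by
  have hBA : B * A = 0 := by
    have := congrArg Matrix.conjTranspose hAB
    simpa [hA.1.eq, hB.1.eq] using this
  have : (A - B)ᴴ * (A - B) = (A + B) * (A + B) := by
    rw [Matrix.conjTranspose_sub, hA.1.eq, hB.1.eq]
    simp [Matrix.sub_mul, Matrix.mul_sub, Matrix.add_mul, Matrix.mul_add, hAB, hBA]
  rw [traceNorm, this, cfc_sqrt_mul_self (hA.add hB), Matrix.trace_add]

/-- The optimal observable is the sign `2R - 1`, with `R` the projection separating the positive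
from the negative part. -/
theorem exists_trace_mul_eq_traceNorm {M : Matrix n n ℂ} (hM : M.IsHermitian) :
    ∃ Z : Matrix n n ℂ, (1 - Z).PosSemidef ∧ (1 + Z).PosSemidef ∧
      (M * Z).trace.re = traceNorm M := by
  obtain ⟨A, B, R, hA, hB, hR, hR2, rfl, hRA, hRB⟩ := exists_jordan hM
  have hAR : A * R = A := by simpa [hA.1.eq, hR.eq] using congrArg Matrix.conjTranspose hRA
  have hBR : B * R = 0 := by simpa [hB.1.eq, hR.eq] using congrArg Matrix.conjTranspose hRB
  have hAB : A * B = 0 := by rw [← hAR, Matrix.mul_assoc, hRB, Matrix.mul_zero]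
  have hP := posSemidef_of_proj hR hR2
  have hP' : (1 - R).PosSemidef := posSemidef_of_proj (by simp [Matrix.IsHermitian, hR.eq])
    (by simp [Matrix.sub_mul, Matrix.mul_sub, hR2])
  refine ⟨2 * R - 1, ?_, ?_, ?_⟩
  · convert hP'.add hP' using 1
    noncomm_ring
  · convert hP.add hP using 1
    noncomm_ring
  · rw [traceNorm_sub hA hB hAB, two_mul, Matrix.mul_sub, Matrix.mul_add, Matrix.sub_mul, hAR, hBR,
      Matrix.mul_one]
    congr 1
    simp

theorem trace_mul_le_trace_add {A B Z : Matrix n n ℂ} (hA : A.PosSemidef) (hB : B.PosSemidef)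
    (hZ1 : (1 - Z).PosSemidef) (hZ2 : (1 + Z).PosSemidef) :
    ((A - B) * Z).trace.re ≤ (A.trace + B.trace).re := by
  have h1 := PosSemidef.trace_mul_nonneg hA hZ1
  have h2 := PosSemidef.trace_mul_nonneg hB hZ2
  have h1 := (Complex.le_def.mp h1).1
  have h2 := (Complex.le_def.mp h2).1
  simp only [Matrix.mul_sub, Matrix.mul_one, Matrix.mul_add, Matrix.trace_sub, Matrix.trace_add,
    Matrix.sub_mul, Complex.sub_re, Complex.add_re, Complex.zero_re] at *
  linarith

/-- The equality case of `trace_mul_le_trace_add`: the nonnegative traces of `A * (1 - Z)` and `B *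
(1 + Z)` sum to zero, so both products vanish. -/
theorem mul_eq_of_trace_add_le {A B Z : Matrix n n ℂ} (hA : A.PosSemidef) (hB : B.PosSemidef)
    (hZ1 : (1 - Z).PosSemidef) (hZ2 : (1 + Z).PosSemidef)
    (h : (A.trace + B.trace).re ≤ ((A - B) * Z).trace.re) : A * Z = A ∧ B * Z = -B := by
  have h1 := PosSemidef.trace_mul_nonneg hA hZ1
  have h2 := PosSemidef.trace_mul_nonneg hB hZ2
  have h1' := Complex.le_def.mp h1
  have h2' := Complex.le_def.mp h2
  have e : (A * (1 - Z)).trace.re + (B * (1 + Z)).trace.re ≤ 0 := by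
    simp only [Matrix.mul_sub, Matrix.mul_one, Matrix.mul_add, Matrix.trace_sub, Matrix.trace_add,
      Matrix.sub_mul, Complex.sub_re, Complex.add_re] at *
    linarith
  have e1 := PosSemidef.mul_eq_zero_of_trace hA hZ1 (Complex.ext
    (by simp only [Complex.zero_re] at *; linarith) (by simpa using h1'.2.symm))
  have e2 := PosSemidef.mul_eq_zero_of_trace hB hZ2 (Complex.ext
    (by simp only [Complex.zero_re] at *; linarith) (by simpa using h2'.2.symm))
  rw [Matrix.mul_sub, Matrix.mul_one, sub_eq_zero] at e1
  rw [Matrix.mul_add, Matrix.mul_one] at e2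
  exact ⟨e1.symm, eq_neg_of_add_eq_zero_right e2⟩

theorem traceNorm_sub_le {A B : Matrix n n ℂ} (hA : A.PosSemidef) (hB : B.PosSemidef) :
    traceNorm (A - B) ≤ (A.trace + B.trace).re := by
  obtain ⟨Z, h1, h2, h3⟩ := exists_trace_mul_eq_traceNorm (hA.1.sub hB.1)
  rw [← h3]
  exact trace_mul_le_trace_add hA hB h1 h2

theorem exists_posSemidef_sub {M : Matrix n n ℂ} (hM : M.IsHermitian) :
    ∃ A B : Matrix n n ℂ, A.PosSemidef ∧ B.PosSemidef ∧ A * B = 0 ∧ M = A - B ∧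
      traceNorm M = (A.trace + B.trace).re := by
  obtain ⟨A, B, R, hA, hB, hR, hR2, rfl, hRA, hRB⟩ := exists_jordan hM
  have hAR : A * R = A := by simpa [hA.1.eq, hR.eq] using congrArg Matrix.conjTranspose hRA
  have hAB : A * B = 0 := by rw [← hAR, Matrix.mul_assoc, hRB, Matrix.mul_zero]
  exact ⟨A, B, hA, hB, hAB, rfl, traceNorm_sub hA hB hAB⟩

theorem trace_mul_le_traceNorm {M Z : Matrix n n ℂ} (hM : M.IsHermitian)
    (hZ1 : (1 - Z).PosSemidef) (hZ2 : (1 + Z).PosSemidef) :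
    (M * Z).trace.re ≤ traceNorm M := by
  obtain ⟨A, B, hA, hB, -, rfl, h⟩ := exists_posSemidef_sub hM
  rw [h]
  exact trace_mul_le_trace_add hA hB hZ1 hZ2

end LinearAlgebra

/-! ### Duality, supports of fixed points, invariance under Kraus operators. -/

section Channel

set_option linter.unusedSectionVars false

variable {n ι : Type*} [Fintype n] [Fintype ι]

theorem channel_apply (K : ι → Matrix n n ℂ) (ρ : Matrix n n ℂ) :
    channel K ρ = ∑ i, K i * ρ * (K i)ᴴ := rfl

theorem dualChannel_apply (K : ι → Matrix n n ℂ) (X : Matrix n n ℂ) :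
    dualChannel K X = ∑ i, (K i)ᴴ * X * K i := by
  simp [dualChannel, channel_apply]

theorem trace_channel_mul (K : ι → Matrix n n ℂ) (ρ X : Matrix n n ℂ) :
    (channel K ρ * X).trace = (ρ * dualChannel K X).trace := by
  rw [channel_apply, dualChannel_apply, Matrix.sum_mul, Matrix.mul_sum, Matrix.trace_sum,
    Matrix.trace_sum]
  refine Finset.sum_congr rfl fun i _ => ?_
  rw [Matrix.mul_assoc, Matrix.mul_assoc, Matrix.trace_mul_comm]
  simp only [Matrix.mul_assoc]

theorem posSemidef_channel (K : ι → Matrix n n ℂ) {ρ : Matrix n n ℂ} (h : ρ.PosSemidef) :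
    (channel K ρ).PosSemidef :=
  Matrix.posSemidef_sum _ fun i _ => h.mul_mul_conjTranspose_same (K i)

theorem posSemidef_dualChannel (K : ι → Matrix n n ℂ) {X : Matrix n n ℂ} (h : X.PosSemidef) :
    (dualChannel K X).PosSemidef :=
  posSemidef_channel _ h

theorem channel_conjTranspose (K : ι → Matrix n n ℂ) (ρ : Matrix n n ℂ) :
    channel K ρᴴ = (channel K ρ)ᴴ := by
  simp [channel_apply, Matrix.conjTranspose_sum, Matrix.mul_assoc]

/-- Together with `eq_zero_of_sum_conjTranspose_mul_self` this turns the operator equation `R *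
E†(Q) * R = 0` into the vanishing of every block `Q * K i * R`. -/
theorem sum_conjTranspose_mul_kraus (K : ι → Matrix n n ℂ) {Q R : Matrix n n ℂ}
    (hQ : Q.IsHermitian) (hQ2 : Q * Q = Q) (hR : R.IsHermitian) :
    ∑ i, (Q * K i * R)ᴴ * (Q * K i * R) = R * dualChannel K Q * R := by
  rw [dualChannel_apply, Matrix.mul_sum, Matrix.sum_mul]
  refine Finset.sum_congr rfl fun i _ => ?_
  rw [Matrix.conjTranspose_mul, Matrix.conjTranspose_mul, hQ.eq, hR.eq]
  calc _ = R * ((K i)ᴴ * (Q * Q) * K i) * R := by simp only [Matrix.mul_assoc]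
    _ = _ := by rw [hQ2]

variable [DecidableEq n]

theorem dualChannel_one {K : ι → Matrix n n ℂ} (hK : ∑ i, (K i)ᴴ * K i = 1) :
    dualChannel K 1 = 1 := by
  simp [dualChannel_apply, hK]

theorem trace_channel {K : ι → Matrix n n ℂ} (hK : ∑ i, (K i)ᴴ * K i = 1) (ρ : Matrix n n ℂ) :
    (channel K ρ).trace = ρ.trace := by
  have := trace_channel_mul K ρ 1
  rwa [dualChannel_one hK, Matrix.mul_one, Matrix.mul_one] at this

/-! ### Fixed points -/

/-- The positive and negative parts of a Hermitian fixed point are fixed. -/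
theorem exists_fixed_posSemidef_sub {K : ι → Matrix n n ℂ} (hK : ∑ i, (K i)ᴴ * K i = 1)
    {M : Matrix n n ℂ} (hM : M.IsHermitian) (hfix : channel K M = M) :
    ∃ A B : Matrix n n ℂ, A.PosSemidef ∧ B.PosSemidef ∧ M = A - B ∧
      channel K A = A ∧ channel K B = B := by
  obtain ⟨A, B, R, hA, hB, hR, hR2, rfl, hRA, hRB⟩ := exists_jordan hM
  have hP := posSemidef_of_proj hR hR2
  have hP' : (1 - R).PosSemidef := posSemidef_of_proj (by simp [Matrix.IsHermitian, hR.eq])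
    (by simp [Matrix.sub_mul, Matrix.mul_sub, hR2])
  rw [map_sub] at hfix
  have hEA := posSemidef_channel K hA
  have hEB := posSemidef_channel K hB
  have h1 : R * channel K A - R * channel K B = A := by
    rw [← Matrix.mul_sub, hfix, Matrix.mul_sub, hRA, hRB, sub_zero]
  -- Trace preservation gives `tr E(A) = tr A`; the two nonnegative defects then sum to zero, so `R`
  -- also separates `E(A)` from `E(B)`.
  have h2 : ((1 - R) * channel K A).trace + (R * channel K B).trace = 0 := by
    have := congrArg Matrix.trace h1
    rw [← trace_channel hK A] at this
    simp only [Matrix.sub_mul, Matrix.one_mul, Matrix.trace_sub] at *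
    linear_combination -this
  have h3 := (add_eq_zero_iff_of_nonneg (PosSemidef.trace_mul_nonneg hP' hEA)
    (PosSemidef.trace_mul_nonneg hP hEB)).mp h2
  have h4 := PosSemidef.mul_eq_zero_of_trace hP' hEA h3.1
  have h5 := PosSemidef.mul_eq_zero_of_trace hP hEB h3.2
  rw [Matrix.sub_mul, Matrix.one_mul, sub_eq_zero] at h4
  rw [h5, sub_zero, ← h4] at h1
  refine ⟨A, B, hA, hB, rfl, h1, ?_⟩
  rwa [h1, sub_right_inj] at hfix

theorem PosSemidef.mul_eq_zero_of_add_mul {A B Y : Matrix n n ℂ} (hA : A.PosSemidef)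
    (hB : B.PosSemidef) (h : (A + B) * Y = 0) : A * Y = 0 := by
  have h1 : Yᴴ * A * Y + Yᴴ * B * Y = 0 := by
    rw [← Matrix.add_mul, ← Matrix.mul_add, Matrix.mul_assoc, h, Matrix.mul_zero]
  have hA' := hA.conjTranspose_mul_mul_same Y
  have hB' := hB.conjTranspose_mul_mul_same Y
  have h2 := congrArg Matrix.trace h1
  rw [Matrix.trace_add, Matrix.trace_zero] at h2
  have h3 := (add_eq_zero_iff_of_nonneg hA'.trace_nonneg hB'.trace_nonneg).mp h2
  exact PosSemidef.mul_eq_zero_of_conj hA (hA'.trace_eq_zero_iff.mp h3.1)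

/-- `T` is the sum of the positive and negative parts of the Hermitian matrices `X + Xᴴ` and `i(X -
Xᴴ)`, all fixed; anything killed by a sum of positive operators is killed by each summand. -/
theorem exists_fixed_posSemidef_dominating {K : ι → Matrix n n ℂ}
    (hK : ∑ i, (K i)ᴴ * K i = 1) {X : Matrix n n ℂ} (hX : channel K X = X) :
    ∃ T : Matrix n n ℂ, T.PosSemidef ∧ channel K T = T ∧
      ∀ Y : Matrix n n ℂ, T * Y = 0 → X * Y = 0 := by
  have hX' : channel K Xᴴ = Xᴴ := by rw [channel_conjTranspose, hX]
  obtain ⟨A, B, hA, hB, hAB, hA', hB'⟩ := exists_fixed_posSemidef_sub hK (M := X + Xᴴ)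
    (by simp [Matrix.IsHermitian, add_comm]) (by rw [map_add, hX, hX'])
  obtain ⟨C, D, hC, hD, hCD, hC', hD'⟩ := exists_fixed_posSemidef_sub hK
    (M := Complex.I • (X - Xᴴ))
    (by simp [Matrix.IsHermitian, Matrix.conjTranspose_smul, smul_sub, neg_add_eq_sub])
    (by rw [map_smul, map_sub, hX, hX'])
  refine ⟨A + (B + (C + D)), hA.add (hB.add (hC.add hD)), by simp [hA', hB', hC', hD'],
    fun Y hY => ?_⟩
  have hAY := PosSemidef.mul_eq_zero_of_add_mul hA (hB.add (hC.add hD)) hY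
  rw [Matrix.add_mul, hAY, zero_add] at hY
  have hBY := PosSemidef.mul_eq_zero_of_add_mul hB (hC.add hD) hY
  rw [Matrix.add_mul, hBY, zero_add] at hY
  have hCY := PosSemidef.mul_eq_zero_of_add_mul hC hD hY
  rw [Matrix.add_mul, hCY, zero_add] at hY
  have h1 : (X + Xᴴ) * Y = 0 := by rw [hAB, Matrix.sub_mul, hAY, hBY, sub_zero]
  have h2 : Complex.I • ((X - Xᴴ) * Y) = 0 := by
    rw [← Matrix.smul_mul, hCD, Matrix.sub_mul, hCY, hY, sub_zero]
  rw [smul_eq_zero_iff_right Complex.I_ne_zero] at h2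
  have h3 : (2 : ℂ) • (X * Y) = 0 := by
    rw [← add_zero (0 : Matrix n n ℂ)]
    nth_rw 1 [← h1]
    rw [← h2, Matrix.add_mul, Matrix.sub_mul, two_smul]; abel
  simpa using h3

theorem exists_fixed_posSemidef_forall_dominating {K : ι → Matrix n n ℂ}
    (hK : ∑ i, (K i)ᴴ * K i = 1) :
    ∃ T : Matrix n n ℂ, T.PosSemidef ∧ channel K T = T ∧
      ∀ X, channel K X = X → ∀ Y : Matrix n n ℂ, T * Y = 0 → X * Y = 0 := by
  obtain ⟨S, hS⟩ := IsNoetherian.noetherian (LinearMap.ker (channel K - LinearMap.id))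
  have hmem : ∀ X, X ∈ Submodule.span ℂ (S : Set (Matrix n n ℂ)) ↔ channel K X = X := by
    intro X; rw [hS]; simp [sub_eq_zero]
  have : ∀ X : Matrix n n ℂ, ∃ T : Matrix n n ℂ, X ∈ S → T.PosSemidef ∧ channel K T = T ∧
      ∀ Y : Matrix n n ℂ, T * Y = 0 → X * Y = 0 := by
    intro X
    by_cases hX : X ∈ S
    · obtain ⟨T, hT⟩ := exists_fixed_posSemidef_dominating hK
        ((hmem X).mp (Submodule.subset_span hX))
      exact ⟨T, fun _ => hT⟩
    · exact ⟨0, fun h => (hX h).elim⟩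
  choose T hT using this
  refine ⟨∑ X ∈ S, T X, Matrix.posSemidef_sum _ fun X hX => (hT X hX).1, ?_, ?_⟩
  · rw [map_sum]
    exact Finset.sum_congr rfl fun X hX => (hT X hX).2.1
  · intro X hX Y hY
    rw [← hmem] at hX
    induction hX using Submodule.span_induction with
    | mem Z hZ =>
      refine (hT Z hZ).2.2 Y ?_
      rw [← Finset.add_sum_erase S T hZ] at hY
      exact PosSemidef.mul_eq_zero_of_add_mul (hT Z hZ).1
        (Matrix.posSemidef_sum _ fun X hX => (hT X (Finset.mem_of_mem_erase hX)).1) hY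
    | zero => simp
    | add Z Z' _ _ h h' => rw [Matrix.add_mul, h, h', add_zero]
    | smul c Z _ h => rw [Matrix.smul_mul, h, smul_zero]

/-- A projection `P₀` onto the support of the fixed points is the support of a fixed state. -/
theorem exists_fixed_of_range_eq_fixedSupport {K : ι → Matrix n n ℂ}
    (hK : ∑ i, (K i)ᴴ * K i = 1) {P₀ : Matrix n n ℂ} (hP : P₀.IsHermitian) (hP2 : P₀ * P₀ = P₀)
    (hr : LinearMap.range P₀.mulVecLin = fixedSupport (channel K)) :
    ∃ ρ₀ : Matrix n n ℂ, ρ₀.PosSemidef ∧ channel K ρ₀ = ρ₀ ∧ P₀ * ρ₀ = ρ₀ ∧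
      ∀ Y : Matrix n n ℂ, ρ₀ * Y = 0 → P₀ * Y = 0 := by
  obtain ⟨ρ₀, h1, h2, h3⟩ := exists_fixed_posSemidef_forall_dominating hK
  refine ⟨ρ₀, h1, h2, ?_, fun Y hY => ?_⟩
  · apply Matrix.ext_of_mulVec_single
    intro i
    have hle : LinearMap.range ρ₀.mulVecLin ≤ fixedSupport (channel K) :=
      le_iSup₂_of_le (f := fun (X : Matrix n n ℂ) (_ : X ∈ {X : Matrix n n ℂ | channel K X = X}) =>
        LinearMap.range X.mulVecLin) ρ₀ h2 le_rfl
    obtain ⟨v, hv⟩ := hr ▸ hle ⟨Pi.single i 1, rfl⟩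
    rw [Matrix.mulVecLin_apply, Matrix.mulVecLin_apply] at hv
    rw [← Matrix.mulVec_mulVec, ← hv, Matrix.mulVec_mulVec, hP2]
  · have hle : fixedSupport (channel K) ≤ LinearMap.ker Yᴴ.mulVecLin := by
      refine iSup₂_le fun X hX => ?_
      rintro _ ⟨v, rfl⟩
      have : Xᴴ * Y = 0 := h3 _ (by rw [channel_conjTranspose, hX]) Y hY
      have : Yᴴ * X = 0 := by simpa using congrArg Matrix.conjTranspose this
      rw [LinearMap.mem_ker, Matrix.mulVecLin_apply, Matrix.mulVecLin_apply, Matrix.mulVec_mulVec,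
        this, Matrix.zero_mulVec]
    have : Yᴴ * P₀ = 0 := by
      apply Matrix.ext_of_mulVec_single
      intro i
      have : P₀.mulVecLin (Pi.single i 1) ∈ LinearMap.ker Yᴴ.mulVecLin := hle (hr ▸ ⟨_, rfl⟩)
      rw [LinearMap.mem_ker, Matrix.mulVecLin_apply, Matrix.mulVecLin_apply,
        Matrix.mulVec_mulVec] at this
      rw [this, Matrix.zero_mulVec]
    simpa [hP.eq] using congrArg Matrix.conjTranspose this

/-- The Kraus operators leave the support of a fixed state invariant. -/
theorem kraus_mul_support {K : ι → Matrix n n ℂ}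
    {ρ R : Matrix n n ℂ} (hρ : ρ.PosSemidef) (hfix : channel K ρ = ρ) (hR : R.IsHermitian)
    (hR2 : R * R = R) (hRρ : R * ρ = ρ) (hker : ∀ Y : Matrix n n ℂ, ρ * Y = 0 → R * Y = 0)
    (i : ι) : R * K i * R = K i * R := by
  have hP' : (1 - R).PosSemidef := posSemidef_of_proj (by simp [Matrix.IsHermitian, hR.eq])
    (by simp [Matrix.sub_mul, Matrix.mul_sub, hR2])
  have hρR : ρ * R = ρ := by simpa [hρ.1.eq, hR.eq] using congrArg Matrix.conjTranspose hRρ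
  -- A fixed state supported in `R` puts no weight outside `R` after the channel; faithfulness of
  -- `ρ` on `R` upgrades this to an operator identity.
  have h1 : (ρ * dualChannel K (1 - R)).trace = 0 := by
    rw [← trace_channel_mul, hfix, Matrix.mul_sub, hρR, Matrix.mul_one, sub_self,
      Matrix.trace_zero]
  have h2 := hker _ (PosSemidef.mul_eq_zero_of_trace hρ (posSemidef_dualChannel K hP') h1)
  have h3 : ∑ i, ((1 - R) * K i * R)ᴴ * ((1 - R) * K i * R) = 0 := by
    have hq : (1 - R) * (1 - R) = 1 - R := by simp [Matrix.sub_mul, Matrix.mul_sub, hR2]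
    rw [sum_conjTranspose_mul_kraus K hP'.1 hq hR, h2, Matrix.zero_mul]
  have h4 := eq_zero_of_sum_conjTranspose_mul_self h3 i
  rw [Matrix.sub_mul, Matrix.sub_mul, Matrix.one_mul, sub_eq_zero] at h4
  exact h4.symm

theorem mul_dualChannel_of_invariant {K : ι → Matrix n n ℂ} (hK : ∑ i, (K i)ᴴ * K i = 1)
    {R : Matrix n n ℂ} (hR : R.IsHermitian) (h : ∀ i, R * K i * R = K i * R) :
    R * dualChannel K R = R := by
  calc R * dualChannel K R = ∑ i, (R * K i * R)ᴴ * K i := by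
        rw [dualChannel_apply, Matrix.mul_sum]
        refine Finset.sum_congr rfl fun i _ => ?_
        simp only [Matrix.conjTranspose_mul, hR.eq, Matrix.mul_assoc]
    _ = R * ∑ i, (K i)ᴴ * K i := by
        rw [Matrix.mul_sum]
        refine Finset.sum_congr rfl fun i _ => ?_
        rw [h, Matrix.conjTranspose_mul, hR.eq, Matrix.mul_assoc]
    _ = R := by rw [hK, Matrix.mul_one]

end Channel

/-! ### Invariance of single sectors and their fixed states. -/

section Sector

set_option linter.unusedSectionVars false

variable {n ι κ : Type*} [Fintype n] [DecidableEq n] [Fintype ι] [Fintype κ]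
  {a b : κ → Type*} [∀ k, Fintype (a k)] [∀ k, DecidableEq (a k)]
  [∀ k, Fintype (b k)] [∀ k, DecidableEq (b k)]
  {K : ι → Matrix n n ℂ} {V : ∀ k, Matrix n (a k × b k) ℂ}

theorem isHermitian_totalProj (V : ∀ k, Matrix n (a k × b k) ℂ) : (totalProj V).IsHermitian := by
  simp [Matrix.IsHermitian, totalProj, Matrix.conjTranspose_sum]

theorem IsSectorDecomposition.totalProj_mul_isometry (hV : IsSectorDecomposition K V) (k : κ) :
    totalProj V * V k = V k := by
  rw [totalProj, Matrix.sum_mul, Finset.sum_eq_single k]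
  · rw [Matrix.mul_assoc, hV.isometry, Matrix.mul_one]
  · intro l _ hl
    rw [Matrix.mul_assoc, hV.orthogonal l k hl, Matrix.mul_zero]
  · simp

theorem IsSectorDecomposition.isometry_mul_totalProj (hV : IsSectorDecomposition K V) (k : κ) :
    (V k)ᴴ * totalProj V = (V k)ᴴ := by
  simpa [(isHermitian_totalProj V).eq] using
    congrArg Matrix.conjTranspose (hV.totalProj_mul_isometry k)

theorem IsSectorDecomposition.totalProj_mul_self (hV : IsSectorDecomposition K V) :
    totalProj V * totalProj V = totalProj V := by
  nth_rw 2 [totalProj]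
  rw [Matrix.mul_sum]
  refine Finset.sum_congr rfl fun k _ => ?_
  rw [← Matrix.mul_assoc, hV.totalProj_mul_isometry]

theorem IsSectorDecomposition.exists_fixed (hV : IsSectorDecomposition K V)
    (hK : ∑ i, (K i)ᴴ * K i = 1) :
    ∃ ρ₀ : Matrix n n ℂ, ρ₀.PosSemidef ∧ channel K ρ₀ = ρ₀ ∧ totalProj V * ρ₀ = ρ₀ ∧
      ∀ Y : Matrix n n ℂ, ρ₀ * Y = 0 → totalProj V * Y = 0 :=
  exists_fixed_of_range_eq_fixedSupport hK (isHermitian_totalProj V) hV.totalProj_mul_self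
    hV.support

theorem IsSectorDecomposition.kraus_mul_totalProj (hV : IsSectorDecomposition K V)
    (hK : ∑ i, (K i)ᴴ * K i = 1) (i : ι) :
    totalProj V * K i * totalProj V = K i * totalProj V := by
  obtain ⟨ρ₀, h1, h2, h3, h4⟩ := hV.exists_fixed hK
  exact kraus_mul_support h1 h2 (isHermitian_totalProj V) hV.totalProj_mul_self h3 h4 i

/-- Operators `Y ⊗ 1` on a sector are fixed by the compressed dual channel. -/
theorem IsSectorDecomposition.compress_dualChannel (hV : IsSectorDecomposition K V) (k : κ)
    (Y : Matrix (a k) (a k) ℂ) :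
    totalProj V * dualChannel K (V k * (Y ⊗ₖ (1 : Matrix (b k) (b k) ℂ)) * (V k)ᴴ) * totalProj V =
      V k * (Y ⊗ₖ (1 : Matrix (b k) (b k) ℂ)) * (V k)ᴴ := by
  classical
  refine ((hV.algebra _).mpr ⟨Function.update 0 k Y, ?_⟩).2
  rw [Finset.sum_eq_single k]
  · simp
  · intro l _ hl
    simp [Function.update_of_ne hl]
  · simp

/-- Compressed to `P`, both `E†(P₀)` and `E†(P)` equal `P`, so the blocks from `P` to `P₀ - P`
vanish; those leaving `P₀` vanish already. -/
theorem IsSectorDecomposition.kraus_mul_sector (hV : IsSectorDecomposition K V)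
    (hK : ∑ i, (K i)ᴴ * K i = 1) (k : κ) (i : ι) :
    (V k * (V k)ᴴ) * K i * (V k * (V k)ᴴ) = K i * (V k * (V k)ᴴ) := by
  set P := V k * (V k)ᴴ with hPdef
  set P₀ := totalProj V with hP₀
  have hP : P.IsHermitian := by simp [Matrix.IsHermitian, hPdef]
  have hP0 : P₀.IsHermitian := isHermitian_totalProj V
  have hP0P : P₀ * P = P := by rw [hPdef, ← Matrix.mul_assoc, hV.totalProj_mul_isometry]
  have hPP0 : P * P₀ = P := by rw [hPdef, Matrix.mul_assoc, hV.isometry_mul_totalProj]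
  have hPP : P * P = P := by
    rw [hPdef, Matrix.mul_assoc, ← Matrix.mul_assoc _ (V k), hV.isometry, Matrix.one_mul]
  have h00 : P₀ * P₀ = P₀ := hV.totalProj_mul_self
  have hinv := hV.kraus_mul_totalProj hK
  have e0 : P * dualChannel K P₀ * P = P := by
    have := mul_dualChannel_of_invariant hK hP0 hinv
    rw [← hPP0, Matrix.mul_assoc P P₀, this, hPP0, hPP]
  have e1 : P * dualChannel K P * P = P := by
    have := hV.compress_dualChannel k 1
    rw [Matrix.one_kronecker_one, Matrix.mul_one, ← hPdef, ← hP₀] at this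
    calc P * dualChannel K P * P = (P * P₀) * dualChannel K P * (P₀ * P) := by rw [hPP0, hP0P]
      _ = P * (P₀ * dualChannel K P * P₀) * P := by simp only [Matrix.mul_assoc]
      _ = P := by rw [this, hPP, hPP]
  have e2 : ∑ i, ((P₀ - P) * K i * P)ᴴ * ((P₀ - P) * K i * P) = 0 := by
    have e3 : P * dualChannel K (P₀ - P) * P = 0 := by
      rw [map_sub, Matrix.mul_sub, Matrix.sub_mul, e0, e1, sub_self]
    have hq : (P₀ - P) * (P₀ - P) = P₀ - P := by
      simp [Matrix.sub_mul, Matrix.mul_sub, h00, hP0P, hPP0, hPP]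
    rw [sum_conjTranspose_mul_kraus K (hP0.sub hP) hq hP, e3]
  have h4 := eq_zero_of_sum_conjTranspose_mul_self e2 i
  rw [Matrix.sub_mul, Matrix.sub_mul, sub_eq_zero] at h4
  rw [← h4]
  calc P₀ * K i * P = P₀ * K i * P₀ * P := by rw [Matrix.mul_assoc _ P₀, hP0P]
    _ = K i * P := by rw [hinv, Matrix.mul_assoc, hP0P]

/-- Each sector is the support of a fixed state. -/
theorem IsSectorDecomposition.exists_fixed_sector (hV : IsSectorDecomposition K V)
    (hK : ∑ i, (K i)ᴴ * K i = 1) (k : κ) :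
    ∃ ρ : Matrix n n ℂ, ρ.PosSemidef ∧ channel K ρ = ρ ∧ (V k * (V k)ᴴ) * ρ = ρ ∧
      ∀ Y : Matrix n n ℂ, ρ * Y = 0 → (V k * (V k)ᴴ) * Y = 0 := by
  obtain ⟨ρ₀, h1, h2, h3, h4⟩ := hV.exists_fixed hK
  have hinv := hV.kraus_mul_sector hK k
  have hP : (V k * (V k)ᴴ).IsHermitian := by simp [Matrix.IsHermitian]
  have hPP0 : V k * (V k)ᴴ * totalProj V = V k * (V k)ᴴ := by
    rw [Matrix.mul_assoc, hV.isometry_mul_totalProj]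
  have hP0P : totalProj V * (V k * (V k)ᴴ) = V k * (V k)ᴴ := by
    rw [← Matrix.mul_assoc, hV.totalProj_mul_isometry]
  have hPP : (V k * (V k)ᴴ) * (V k * (V k)ᴴ) = V k * (V k)ᴴ := by
    rw [Matrix.mul_assoc, ← Matrix.mul_assoc _ (V k), hV.isometry, Matrix.one_mul]
  -- No block leads from the other sectors into `P`, since `P₀ * E†(P) * P₀ = P`. Hence compression
  -- by `P` commutes with the channel on operators supported in `P₀`, and `P * ρ₀ * P` is fixed.
  have hcomp : ∀ i, (V k * (V k)ᴴ) * K i * totalProj V = K i * (V k * (V k)ᴴ) := fun i => by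
    have hQ := (isHermitian_totalProj V).sub hP
    have e1 := hV.compress_dualChannel k 1
    rw [Matrix.one_kronecker_one, Matrix.mul_one] at e1
    have e2 := sum_conjTranspose_mul_kraus K hP hPP hQ
    have e3 : (totalProj V - V k * (V k)ᴴ) * totalProj V = totalProj V - V k * (V k)ᴴ := by
      rw [Matrix.sub_mul, hV.totalProj_mul_self, hPP0]
    have e3' : totalProj V * (totalProj V - V k * (V k)ᴴ) = totalProj V - V k * (V k)ᴴ := by
      rw [Matrix.mul_sub, hV.totalProj_mul_self, hP0P]
    have e4 : (totalProj V - V k * (V k)ᴴ) * dualChannel K (V k * (V k)ᴴ) *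
        (totalProj V - V k * (V k)ᴴ) = 0 := by
      calc _ = (totalProj V - V k * (V k)ᴴ) * (totalProj V * dualChannel K (V k * (V k)ᴴ) *
            totalProj V) * (totalProj V - V k * (V k)ᴴ) := by
            conv_lhs => rw [← e3]
            nth_rw 2 [e3]
            conv_lhs => rw [← e3']
            nth_rw 1 [e3']
            simp only [Matrix.mul_assoc]
        _ = 0 := by rw [e1, Matrix.sub_mul, hP0P, hPP, sub_self, Matrix.zero_mul]
    have e5 := eq_zero_of_sum_conjTranspose_mul_self (e2.trans e4) i
    rw [Matrix.mul_sub, hinv, sub_eq_zero] at e5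
    exact e5
  have h3' : ρ₀ * totalProj V = ρ₀ := by
    simpa [h1.1.eq, (isHermitian_totalProj V).eq] using congrArg Matrix.conjTranspose h3
  generalize V k * (V k)ᴴ = P at *
  refine ⟨P * ρ₀ * P, ?_, ?_, ?_, fun Y hY => ?_⟩
  · have := h1.mul_mul_conjTranspose_same P
    rwa [hP.eq] at this
  · nth_rw 2 [← h2]
    rw [channel_apply, channel_apply, Matrix.mul_sum, Matrix.sum_mul]
    refine Finset.sum_congr rfl fun i _ => ?_
    have e : P * (K i)ᴴ = totalProj V * (K i)ᴴ * P := by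
      simpa [hP.eq, (isHermitian_totalProj V).eq, Matrix.mul_assoc] using
        (congrArg Matrix.conjTranspose (hcomp i)).symm
    calc K i * (P * ρ₀ * P) * (K i)ᴴ = (K i * P) * ρ₀ * (P * (K i)ᴴ) := by
          simp only [Matrix.mul_assoc]
      _ = P * K i * (totalProj V * ρ₀ * totalProj V) * (K i)ᴴ * P := by
          rw [← hcomp, e]; simp only [Matrix.mul_assoc]
      _ = P * (K i * ρ₀ * (K i)ᴴ) * P := by rw [h3, h3']; simp only [Matrix.mul_assoc]
  · rw [← Matrix.mul_assoc, ← Matrix.mul_assoc, hPP]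
  · have e : (P * Y)ᴴ * ρ₀ * (P * Y) = 0 := by
      rw [Matrix.conjTranspose_mul, hP.eq]
      calc Yᴴ * P * ρ₀ * (P * Y) = Yᴴ * (P * ρ₀ * P * Y) := by simp only [Matrix.mul_assoc]
        _ = 0 := by rw [hY, Matrix.mul_zero]
    have := h4 _ (PosSemidef.mul_eq_zero_of_conj h1 e)
    rwa [← Matrix.mul_assoc, hP0P] at this

end Sector

/-! ### Operators on an embedded tensor product and the sign of `δ ⊗ τ`. -/

section Place

variable {n α β : Type*} [Fintype n] [DecidableEq n] [Fintype α] [DecidableEq α]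
  [Fintype β] [DecidableEq β]

/-- The operator `Y ⊗ τ` on the subsystem embedded by `W`. -/
noncomputable def place (W : Matrix n (α × β) ℂ) (τ : Matrix β β ℂ) :
    Matrix α α ℂ →ₗ[ℂ] Matrix n n ℂ where
  toFun Y := W * (Y ⊗ₖ τ) * Wᴴ
  map_add' X Y := by rw [Matrix.add_kronecker, Matrix.mul_add, Matrix.add_mul]
  map_smul' c X := by simp [Matrix.smul_kronecker]

set_option linter.unusedSectionVars false

theorem place_apply (W : Matrix n (α × β) ℂ) (τ : Matrix β β ℂ) (Y : Matrix α α ℂ) :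
    place W τ Y = W * (Y ⊗ₖ τ) * Wᴴ := rfl

theorem place_one_one (W : Matrix n (α × β) ℂ) : place W 1 1 = W * Wᴴ := by
  rw [place_apply, Matrix.one_kronecker_one, Matrix.mul_one]

theorem place_conjTranspose (W : Matrix n (α × β) ℂ) (τ : Matrix β β ℂ) (Y : Matrix α α ℂ) :
    (place W τ Y)ᴴ = place W τᴴ Yᴴ := by
  simp only [place_apply, Matrix.conjTranspose_mul, Matrix.conjTranspose_conjTranspose,
    Matrix.conjTranspose_kronecker, Matrix.mul_assoc]

theorem posSemidef_place (W : Matrix n (α × β) ℂ) {τ : Matrix β β ℂ} {Y : Matrix α α ℂ}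
    (hτ : τ.PosSemidef) (hY : Y.PosSemidef) : (place W τ Y).PosSemidef :=
  (hY.kronecker hτ).mul_mul_conjTranspose_same W

theorem place_mul_place {W : Matrix n (α × β) ℂ} (hW : Wᴴ * W = 1) (σ τ : Matrix β β ℂ)
    (X Y : Matrix α α ℂ) : place W σ X * place W τ Y = place W (σ * τ) (X * Y) := by
  simp only [place_apply]
  calc _ = W * (X ⊗ₖ σ) * (Wᴴ * W) * (Y ⊗ₖ τ) * Wᴴ := by simp only [Matrix.mul_assoc]
    _ = _ := by rw [hW, Matrix.mul_one, Matrix.mul_assoc W, ← Matrix.mul_kronecker_mul]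

theorem trace_partialTrace_mul (W : Matrix n (α × β) ℂ) (ρ : Matrix n n ℂ) (Y : Matrix α α ℂ) :
    (partialTrace (Wᴴ * ρ * W) * Y).trace = (ρ * place W 1 Y).trace := by
  have h : ∀ M : Matrix (α × β) (α × β) ℂ,
      (partialTrace M * Y).trace = (M * (Y ⊗ₖ (1 : Matrix β β ℂ))).trace := by
    intro M
    simp only [Matrix.trace, Matrix.diag_apply, Matrix.mul_apply, partialTrace, Matrix.of_apply,
      Fintype.sum_prod_type, Matrix.kroneckerMap_apply, Matrix.one_apply, mul_ite, mul_one,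
      mul_zero, Finset.sum_ite_eq', Finset.mem_univ, if_true, Finset.sum_mul]
    exact Finset.sum_congr rfl fun i _ => Finset.sum_comm
  rw [h, place_apply, Matrix.mul_assoc, Matrix.mul_assoc, Matrix.trace_mul_comm]
  simp only [Matrix.mul_assoc]

/-- The Heisenberg picture of initialization-freeness: `Y ⊗ 1` is fixed for all `Y`. -/
theorem isInitializationFree_iff {ι : Type*} [Fintype ι] (K : ι → Matrix n n ℂ)
    (W : Matrix n (α × β) ℂ) :
    IsInitializationFree (channel K) W ↔ ∀ Y, dualChannel K (place W 1 Y) = place W 1 Y := by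
  constructor
  · intro h Y
    refine eq_of_trace_mul_eq_of_isDensity fun ρ hρ => ?_
    rw [Matrix.trace_mul_comm, ← trace_channel_mul, ← trace_partialTrace_mul, h ρ hρ,
      trace_partialTrace_mul, Matrix.trace_mul_comm]
  · intro h ρ _
    rw [Matrix.ext_iff_trace_mul_right]
    intro Y
    rw [trace_partialTrace_mul, trace_partialTrace_mul, trace_channel_mul, h]

/-- The compression of `E†(P) = P` to `1 - P` is zero, so no Kraus operator maps the complement into
`P`. -/
theorem mul_kraus_comm_of_dualChannel_fixed {ι : Type*} [Fintype ι] {K : ι → Matrix n n ℂ}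
    {P : Matrix n n ℂ} (hP : P.IsHermitian) (hP2 : P * P = P) (h : dualChannel K P = P) (i : ι) :
    P * K i * P = P * K i := by
  have hQ : (1 - P).IsHermitian := Matrix.isHermitian_one.sub hP
  have e : (1 - P) * dualChannel K P * (1 - P) = 0 := by
    simp [h, Matrix.sub_mul, hP2]
  have := eq_zero_of_sum_conjTranspose_mul_self
    ((sum_conjTranspose_mul_kraus K hP hP2 hQ).trans e) i
  rw [Matrix.mul_sub, Matrix.mul_one, sub_eq_zero] at this
  exact this.symm

/-! ### The code of a subsystem -/

theorem convex_subsystemCode (W : Matrix n (α × β) ℂ) (τ : Matrix β β ℂ) :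
    Convex ℝ (subsystemCode W τ) := by
  rintro _ ⟨X, hX, rfl⟩ _ ⟨Y, hY, rfl⟩ p q hp hq hpq
  refine ⟨(p : ℂ) • X + (q : ℂ) • Y, ⟨?_, ?_⟩, ?_⟩
  · exact (hX.1.smul (Complex.zero_le_real.mpr hp)).add (hY.1.smul (Complex.zero_le_real.mpr hq))
  · rw [Matrix.trace_add, Matrix.trace_smul, Matrix.trace_smul, hX.2, hY.2, smul_eq_mul,
      smul_eq_mul, mul_one, mul_one, ← Complex.ofReal_add, hpq, Complex.ofReal_one]
  · change _ = place W τ _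
    rw [map_add, map_smul, map_smul]
    simp only [place_apply, Complex.coe_smul]

theorem exists_weightedDifference {W : Matrix n (α × β) ℂ} {τ : Matrix β β ℂ} {ρ σ : Matrix n n ℂ}
    (hρ : ρ ∈ subsystemCode W τ) (hσ : σ ∈ subsystemCode W τ) (p : ℝ) :
    ∃ δ : Matrix α α ℂ, δ.IsHermitian ∧
      (p : ℂ) • ρ - ((1 - p : ℝ) : ℂ) • σ = place W τ δ := by
  obtain ⟨X, hX, rfl⟩ := hρ
  obtain ⟨Y, hY, rfl⟩ := hσ
  refine ⟨(p : ℂ) • X - ((1 - p : ℝ) : ℂ) • Y, ?_, ?_⟩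
  · rw [Matrix.IsHermitian, Matrix.conjTranspose_sub, Matrix.conjTranspose_smul,
      Matrix.conjTranspose_smul, hX.1.1.eq, hY.1.1.eq]
    simp only [Complex.star_def, Complex.conj_ofReal]
  · rw [map_sub, map_smul, map_smul]
    rfl

/-- On `A ⊗ B` the eigenvalues are products `d * t` with `t > 0` by full rank, and `f` ignores
positive factors, so `τ` drops out. The complement of the subsystem lies in the kernel and
contributes `f 0`. -/
theorem cfc_place {W : Matrix n (α × β) ℂ} (hW : Wᴴ * W = 1) {τ : Matrix β β ℂ} (hτ : τ.PosDef)
    {δ : Matrix α α ℂ} (hδ : δ.IsHermitian) {f : ℝ → ℝ} (hf : ∀ x t, 0 < t → f (x * t) = f x) :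
    cfc f (place W τ δ) = place W 1 (cfc f δ) + (f 0 : ℂ) • (1 - W * Wᴴ) := by
  have hΔ : (place W τ δ).IsHermitian := by
    rw [Matrix.IsHermitian, place_conjTranspose, hτ.1.eq, hδ.eq]
  obtain ⟨U, d, hU, -, hUd, hUf⟩ := exists_diagonalization hδ
  obtain ⟨T, t, hT, hT', hTd, -⟩ := exists_diagonalization hτ.1
  have ht : ∀ j, 0 < t j := by
    intro j
    have h1 : (Tᴴ * τ * T).PosDef := by
      refine hτ.conjTranspose_mul_mul_same (B := T) ?_
      intro x y hxy
      have := congrArg (Tᴴ.mulVec) hxy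
      simpa [Matrix.mulVec_mulVec, hT'] using this
    rw [Matrix.mul_assoc, hTd, ← Matrix.mul_assoc, hT', Matrix.one_mul] at h1
    have := h1.diag_pos (i := j)
    simpa using this
  have e1 : place W τ δ * (W * (U ⊗ₖ T)) =
      (W * (U ⊗ₖ T)) * Matrix.diagonal fun x : α × β => ((d x.1 * t x.2 : ℝ) : ℂ) := by
    calc place W τ δ * (W * (U ⊗ₖ T)) = W * (δ ⊗ₖ τ) * (Wᴴ * W) * (U ⊗ₖ T) := by
          rw [place_apply]; simp only [Matrix.mul_assoc]
      _ = W * ((δ * U) ⊗ₖ (τ * T)) := by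
          rw [hW, Matrix.mul_one, Matrix.mul_assoc, ← Matrix.mul_kronecker_mul]
      _ = _ := by
          rw [hUd, hTd, Matrix.mul_kronecker_mul, Matrix.diagonal_kronecker_diagonal,
            Matrix.mul_assoc]
          simp
  have e2 := cfc_mul_of_mul_eq_mul_diagonal hΔ e1 f
  have e3 : cfc f (place W τ δ) * (W * (U ⊗ₖ T)) = W * (cfc f δ ⊗ₖ (1 : Matrix β β ℂ)) * (U ⊗ₖ T) := by
    rw [e2, Matrix.mul_assoc W, Matrix.mul_assoc W, ← Matrix.mul_kronecker_mul, hUf,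
      Matrix.one_mul]
    nth_rw 2 [← Matrix.mul_one T]
    rw [Matrix.mul_kronecker_mul, ← Matrix.diagonal_one, Matrix.diagonal_kronecker_diagonal]
    simp [hf _ _ (ht _)]
  have hUT : (U ⊗ₖ T) * (Uᴴ ⊗ₖ Tᴴ) = 1 := by
    rw [← Matrix.mul_kronecker_mul, hU, hT, Matrix.one_kronecker_one]
  have e4 : cfc f (place W τ δ) * W = W * (cfc f δ ⊗ₖ (1 : Matrix β β ℂ)) := by
    have := congrArg (· * (Uᴴ ⊗ₖ Tᴴ)) e3
    simpa only [Matrix.mul_assoc, hUT, Matrix.mul_one] using this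
  have e5 : cfc f (place W τ δ) * (1 - W * Wᴴ) = (f 0 : ℂ) • (1 - W * Wᴴ) := by
    have h0 : place W τ δ * (1 - W * Wᴴ) =
        (1 - W * Wᴴ) * Matrix.diagonal fun _ : n => ((0 : ℝ) : ℂ) := by
      rw [Matrix.mul_sub, place_apply, Matrix.mul_one]
      simp [← Matrix.mul_assoc]
      rw [Matrix.mul_assoc _ _ W, hW, Matrix.mul_one, sub_self]
    rw [cfc_mul_of_mul_eq_mul_diagonal hΔ h0 f]
    ext i j
    simp [mul_comm]
  calc cfc f (place W τ δ) = cfc f (place W τ δ) * W * Wᴴ +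
        cfc f (place W τ δ) * (1 - W * Wᴴ) := by
        rw [Matrix.mul_sub, Matrix.mul_one, Matrix.mul_assoc]; abel
    _ = _ := by rw [e4, e5, place_apply]

theorem posSemidef_helstrom (Δ : Matrix n n ℂ) (s : SignType) : (helstrom Δ s).PosSemidef := by
  open scoped MatrixOrder in
  rw [← Matrix.nonneg_iff_posSemidef]
  exact cfc_nonneg fun x _ => by split_ifs <;> simp

theorem sum_helstrom {Δ : Matrix n n ℂ} (hΔ : Δ.IsHermitian) : ∑ s, helstrom Δ s = 1 := by
  obtain ⟨U, d, hU, -, -, hUf⟩ := exists_diagonalization hΔ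
  have h : (∑ s, helstrom Δ s) * U = U := by
    simp only [helstrom, Matrix.sum_mul, hUf]
    rw [← Matrix.mul_sum]
    conv_rhs => rw [← Matrix.mul_one U]
    congr 1
    ext i j
    by_cases hij : i = j
    · subst hij
      simp [Matrix.sum_apply, apply_ite]
    · simp [Matrix.sum_apply, hij]
  have := congrArg (· * Uᴴ) h
  simpa only [Matrix.mul_assoc, hU, Matrix.mul_one] using this

theorem helstrom_place {W : Matrix n (α × β) ℂ} (hW : Wᴴ * W = 1) {τ : Matrix β β ℂ}
    (hτ : τ.PosDef) {δ : Matrix α α ℂ} (hδ : δ.IsHermitian) (s : SignType) :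
    helstrom (place W τ δ) s =
      place W 1 (helstrom δ s) + (if s = 0 then (1 : ℂ) else 0) • (1 - W * Wᴴ) := by
  rw [helstrom, cfc_place hW hτ hδ]
  · have h : ((if SignType.sign (0 : ℝ) = s then (1 : ℝ) else 0 : ℝ) : ℂ) =
        if s = 0 then (1 : ℂ) else 0 := by
      rw [sign_zero]
      by_cases hs : s = 0
      · simp [hs]
      · simp [hs, Ne.symm hs]
    rw [h]
    rfl
  · intro x t ht
    simp [sign_mul, sign_pos ht]

end Place

/-! ### Initialization-freeness versus noiselessness and unconditional preservation. -/

section Characterization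

set_option linter.unusedSectionVars false

variable {n ι α β : Type*} [Fintype n] [DecidableEq n] [Fintype ι] [Fintype α] [DecidableEq α]
  [Fintype β] [DecidableEq β] {K : ι → Matrix n n ℂ} {W : Matrix n (α × β) ℂ}

theorem isHermitian_proj (W : Matrix n (α × β) ℂ) : (W * Wᴴ).IsHermitian :=
  Matrix.isHermitian_mul_conjTranspose_self W

theorem proj_mul_self (hW : Wᴴ * W = 1) : (W * Wᴴ) * (W * Wᴴ) = W * Wᴴ := by
  rw [Matrix.mul_assoc, ← Matrix.mul_assoc _ W, hW, Matrix.one_mul]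

theorem posSemidef_one_sub_proj (hW : Wᴴ * W = 1) : (1 - W * Wᴴ).PosSemidef :=
  posSemidef_of_proj (Matrix.isHermitian_one.sub (isHermitian_proj W))
    (by rw [Matrix.sub_mul, Matrix.one_mul, Matrix.mul_sub, Matrix.mul_one, proj_mul_self hW,
      sub_self, sub_zero])

theorem posSemidef_channel_pow (K : ι → Matrix n n ℂ) {ρ : Matrix n n ℂ} (h : ρ.PosSemidef)
    (m : ℕ) : ((channel K ^ m) ρ).PosSemidef := by
  induction m with
  | zero => simpa using h
  | succ m ih => rw [pow_succ']; exact posSemidef_channel K ih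

theorem trace_channel_pow_mul {K : ι → Matrix n n ℂ} {Z : Matrix n n ℂ}
    (hZ : dualChannel K Z = Z) (ρ : Matrix n n ℂ) (m : ℕ) :
    ((channel K ^ m) ρ * Z).trace = (ρ * Z).trace := by
  induction m with
  | zero => simp
  | succ m ih => rw [pow_succ', Module.End.mul_apply, trace_channel_mul, hZ, ih]

theorem trace_sum_channel_pow_mul {K : ι → Matrix n n ℂ} {Z : Matrix n n ℂ}
    (hZ : dualChannel K Z = Z) (ρ : Matrix n n ℂ) {s : Finset ℕ} {q : ℕ → ℝ}
    (hq : ∑ m ∈ s, q m = 1) :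
    ((∑ m ∈ s, (q m : ℂ) • channel K ^ m) ρ * Z).trace = (ρ * Z).trace := by
  rw [LinearMap.sum_apply, Matrix.sum_mul, Matrix.trace_sum]
  simp only [LinearMap.smul_apply, Matrix.smul_mul, Matrix.trace_smul, trace_channel_pow_mul hZ]
  rw [← Finset.sum_smul, ← Complex.ofReal_sum, hq, Complex.ofReal_one, one_smul]

theorem posSemidef_sum_channel_pow (K : ι → Matrix n n ℂ) {ρ : Matrix n n ℂ} (h : ρ.PosSemidef)
    {s : Finset ℕ} {q : ℕ → ℝ} (hq : ∀ m ∈ s, 0 ≤ q m) :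
    ((∑ m ∈ s, (q m : ℂ) • channel K ^ m) ρ).PosSemidef := by
  rw [LinearMap.sum_apply]
  exact Matrix.posSemidef_sum _ fun m hm =>
    (posSemidef_channel_pow K h m).smul (Complex.zero_le_real.mpr (hq m hm))

/-- Positive trace-preserving maps cannot increase the trace norm. It cannot decrease either: the
observable `(2R - 1) ⊗ 1`, with `R` splitting `δ`, attains the norm and is fixed by `E†`. Full rank
of `τ` plays no role. -/
theorem isNoiseless_of_isInitializationFree (hK : ∑ i, (K i)ᴴ * K i = 1) (hW : Wᴴ * W = 1)
    {τ : Matrix β β ℂ} (hτ : τ.PosSemidef) (h : IsInitializationFree (channel K) W) :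
    IsNoiseless (channel K) (subsystemCode W τ) := by
  rw [isInitializationFree_iff] at h
  intro s q hq hq1 ρ hρ σ hσ p _ _
  obtain ⟨δ, hδ, hΔ⟩ := exists_weightedDifference hρ hσ p
  rw [hΔ]
  obtain ⟨A, B, R, hA, hB, hR, hR2, rfl, hRA, hRB⟩ := exists_jordan hδ
  have hAR : A * R = A := by simpa [hA.1.eq, hR.eq] using congrArg Matrix.conjTranspose hRA
  have hBR : B * R = 0 := by simpa [hB.1.eq, hR.eq] using congrArg Matrix.conjTranspose hRB
  have hAB : A * B = 0 := by rw [← hAR, Matrix.mul_assoc, hRB, Matrix.mul_zero]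
  have hA' := posSemidef_place W hτ hA
  have hB' := posSemidef_place W hτ hB
  set G := ∑ m ∈ s, (q m : ℂ) • channel K ^ m with hG
  have htr : ∀ X, (G X).trace = X.trace := by
    intro X
    have := trace_sum_channel_pow_mul (dualChannel_one hK) X hq1
    rwa [Matrix.mul_one, Matrix.mul_one] at this
  have hGA : (G (place W τ A)).PosSemidef := posSemidef_sum_channel_pow K hA' hq
  have hGB : (G (place W τ B)).PosSemidef := posSemidef_sum_channel_pow K hB' hq
  have hnorm : traceNorm (place W τ (A - B)) =
      ((place W τ A).trace + (place W τ B).trace).re := by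
    rw [map_sub, traceNorm_sub hA' hB']
    rw [place_mul_place hW, hAB, map_zero]
  have hR1 : (1 - R).PosSemidef := posSemidef_of_proj (Matrix.isHermitian_one.sub hR)
    (by simp [Matrix.sub_mul, Matrix.mul_sub, hR2])
  have hZ : dualChannel K (place W 1 (R + R - 1)) = place W 1 (R + R - 1) := h _
  refine le_antisymm ?_ ?_
  · rw [hnorm, map_sub, map_sub, ← htr (place W τ A), ← htr (place W τ B)]
    exact traceNorm_sub_le hGA hGB
  · have h1 : ((G (place W τ (A - B))) * place W 1 (R + R - 1)).trace.re ≤ _ :=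
      trace_mul_le_traceNorm ?_ ?_ ?_
    · refine le_trans (le_of_eq ?_) h1
      rw [trace_sum_channel_pow_mul hZ _ hq1, hnorm, place_mul_place hW, Matrix.mul_one]
      rw [← Matrix.trace_add, ← map_add]
      congr 4
      simp [Matrix.sub_mul, Matrix.mul_sub, Matrix.mul_add, hAR, hBR]
    · rw [map_sub, map_sub]
      exact hGA.1.sub hGB.1
    · convert (posSemidef_one_sub_proj hW).add ((posSemidef_place W .one hR1).add
        (posSemidef_place W .one hR1)) using 1
      simp only [map_sub, map_add, place_one_one]
      abel
    · convert (posSemidef_one_sub_proj hW).add ((posSemidef_place W .one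
        (posSemidef_of_proj hR hR2)).add (posSemidef_place W .one
        (posSemidef_of_proj hR hR2))) using 1
      simp only [map_sub, map_add, place_one_one]
      abel

theorem isUnconditionallyPreserved_of_isInitializationFree (hK : ∑ i, (K i)ᴴ * K i = 1)
    (hW : Wᴴ * W = 1) {τ : Matrix β β ℂ} (hτ : τ.PosDef)
    (h : IsInitializationFree (channel K) W) :
    IsUnconditionallyPreserved (channel K) (subsystemCode W τ) := by
  rw [isInitializationFree_iff] at h
  intro ρ hρ σ hσ p _ _
  rw [(convex_subsystemCode W τ).convexHull_eq] at hρ hσ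
  obtain ⟨δ, hδ, hΔ⟩ := exists_weightedDifference hρ hσ p
  rw [hΔ]
  have hΔh : (place W τ δ).IsHermitian := by
    rw [Matrix.IsHermitian, place_conjTranspose, hτ.1.eq, hδ.eq]
  refine ⟨helstrom (place W τ δ), posSemidef_helstrom _, sum_helstrom hΔh, fun ω _ s => ?_⟩
  have hfix : dualChannel K (helstrom (place W τ δ) s) = helstrom (place W τ δ) s := by
    rw [helstrom_place hW hτ hδ, map_add, h, map_smul, map_sub, dualChannel_one hK,
      ← place_one_one, h]
  rw [Matrix.trace_mul_comm, Matrix.trace_mul_comm _ (channel K ω), trace_channel_mul, hfix]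

theorem IsMeasurementPreserved.exists_dualChannel_eq {κ : Type*} [Fintype κ] [DecidableEq κ]
    {M : κ → Matrix n n ℂ} (h : IsMeasurementPreserved (channel K) M) (x : κ) :
    ∃ Q : Matrix n n ℂ, Q.PosSemidef ∧ (1 - Q).PosSemidef ∧ dualChannel K Q = M x := by
  obtain ⟨Q, hQ, hQ1, hQM⟩ := h
  refine ⟨Q x, hQ x, ?_, ?_⟩
  · rw [← hQ1, ← Finset.add_sum_erase _ _ (Finset.mem_univ x), add_sub_cancel_left]
    exact Matrix.posSemidef_sum _ fun y _ => hQ y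
  · refine eq_of_trace_mul_eq_of_isDensity fun ρ hρ => ?_
    rw [hQM ρ hρ x, Matrix.trace_mul_comm, ← trace_channel_mul, Matrix.trace_mul_comm]

/-- If the projection `P` on the support of a fixed state is the image of an effect under the dual
channel, then the Kraus operators commute with `P`. -/
theorem kraus_comm_of_dualChannel_eq {P Q ρ : Matrix n n ℂ}
    (hP : P.IsHermitian) (hP2 : P * P = P) (hρ : ρ.PosSemidef) (hfix : channel K ρ = ρ)
    (hPρ : P * ρ = ρ) (hker : ∀ Y : Matrix n n ℂ, ρ * Y = 0 → P * Y = 0)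
    (hQ : Q.PosSemidef) (hQ1 : (1 - Q).PosSemidef) (hQP : dualChannel K Q = P) (i : ι) :
    P * K i = K i * P := by
  have hρP : ρ * P = ρ := by simpa [hρ.1.eq, hP.eq] using congrArg Matrix.conjTranspose hPρ
  -- `tr(ρ Q) = tr(E(ρ) Q) = tr(ρ P) = tr ρ`, so `Q` acts as the identity on the support `P` of `ρ`.
  have h1 : (ρ * (1 - Q)).trace = 0 := by
    rw [Matrix.mul_sub, Matrix.trace_sub]
    nth_rw 2 [← hfix]
    rw [trace_channel_mul, hQP, hρP, Matrix.mul_one, sub_self]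
  have h2 := hker _ (PosSemidef.mul_eq_zero_of_trace hρ hQ1 h1)
  rw [Matrix.mul_sub, Matrix.mul_one, sub_eq_zero] at h2
  have h3 : Q * P = P := by
    simpa [hQ.1.eq, hP.eq] using (congrArg Matrix.conjTranspose h2).symm
  have hP1 : (1 - P).IsHermitian := Matrix.isHermitian_one.sub hP
  have h4 : (Q - P).PosSemidef := by
    have := hQ.conjTranspose_mul_mul_same (1 - P)
    rw [hP1.eq] at this
    convert this using 1
    simp [Matrix.sub_mul, Matrix.mul_sub, ← h2, h3]
    rw [hP2, sub_self, sub_zero]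
  -- Since `Q = P + (Q - P)` with `Q - P ≥ 0`, and `E†(Q) = P` vanishes off `P`, so does the smaller
  -- `E†(P)`.
  have h5 : (1 - P) * dualChannel K P * (1 - P) + (1 - P) * dualChannel K (Q - P) * (1 - P) = 0 := by
    rw [← Matrix.add_mul, ← Matrix.mul_add, ← map_add, add_sub_cancel, hQP]
    simp [Matrix.sub_mul, hP2]
  have h6 : ((1 - P) * dualChannel K P * (1 - P)).PosSemidef := by
    have := (posSemidef_dualChannel K (posSemidef_of_proj hP hP2)).conjTranspose_mul_mul_same (1 - P)
    rwa [hP1.eq] at this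
  have h7 : ((1 - P) * dualChannel K (Q - P) * (1 - P)).PosSemidef := by
    have := (posSemidef_dualChannel K h4).conjTranspose_mul_mul_same (1 - P)
    rwa [hP1.eq] at this
  have h8 := congrArg Matrix.trace h5
  rw [Matrix.trace_add, Matrix.trace_zero] at h8
  have h9 := h6.trace_eq_zero_iff.mp
    ((add_eq_zero_iff_of_nonneg h6.trace_nonneg h7.trace_nonneg).mp h8).1
  have h10 := eq_zero_of_sum_conjTranspose_mul_self
    ((sum_conjTranspose_mul_kraus K hP hP2 hP1).trans h9) i
  rw [Matrix.mul_sub, Matrix.mul_one, sub_eq_zero] at h10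
  rw [h10, kraus_mul_support hρ hfix hP hP2 hPρ hker]

theorem dualChannel_mul_of_comm {P : Matrix n n ℂ} (hP : P.IsHermitian)
    (h : ∀ i, P * K i = K i * P) (X : Matrix n n ℂ) :
    dualChannel K (P * X) = P * dualChannel K X := by
  rw [dualChannel_apply, dualChannel_apply, Matrix.mul_sum]
  refine Finset.sum_congr rfl fun i _ => ?_
  have : (K i)ᴴ * P = P * (K i)ᴴ := by
    simpa [hP.eq] using congrArg Matrix.conjTranspose (h i)
  rw [← Matrix.mul_assoc, this]
  simp only [Matrix.mul_assoc]

/-- If averaging `Δ = A - B` with its image preserves the trace norm, then some `Z` measures the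
sign of `Δ` both before and after the channel. -/
theorem exists_sign_of_traceNorm_average (hK : ∑ i, (K i)ᴴ * K i = 1) {A B : Matrix n n ℂ}
    (hA : A.PosSemidef) (hB : B.PosSemidef) (hAB : A * B = 0)
    (h : traceNorm ((2⁻¹ : ℂ) • (A - B) + (2⁻¹ : ℂ) • channel K (A - B)) = traceNorm (A - B)) :
    ∃ Z : Matrix n n ℂ, A * Z = A ∧ B * Z = -B ∧
      A * dualChannel K Z = A ∧ B * dualChannel K Z = -B := by
  rw [traceNorm_sub hA hB hAB] at h
  have h2 : (0 : ℂ) ≤ 2⁻¹ := by simp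
  have hM : ((2⁻¹ : ℂ) • (A - B) + (2⁻¹ : ℂ) • channel K (A - B)).IsHermitian := by
    have e : (2⁻¹ : ℂ) • (A - B) + (2⁻¹ : ℂ) • channel K (A - B) =
        ((2⁻¹ : ℂ) • A + (2⁻¹ : ℂ) • channel K A) - ((2⁻¹ : ℂ) • B + (2⁻¹ : ℂ) • channel K B) := by
      rw [map_sub, smul_sub, smul_sub]; abel
    rw [e]
    exact ((hA.smul h2).add ((posSemidef_channel K hA).smul h2)).1.sub
      ((hB.smul h2).add ((posSemidef_channel K hB).smul h2)).1
  obtain ⟨Z, hZ1, hZ2, hZ⟩ := exists_trace_mul_eq_traceNorm hM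
  have hE1 : (1 - dualChannel K Z).PosSemidef := by
    have := posSemidef_dualChannel K hZ1
    rwa [map_sub, dualChannel_one hK] at this
  have hE2 : (1 + dualChannel K Z).PosSemidef := by
    have := posSemidef_dualChannel K hZ2
    rwa [map_add, dualChannel_one hK] at this
  have l1 := trace_mul_le_trace_add hA hB hZ1 hZ2
  have l2 := trace_mul_le_trace_add hA hB hE1 hE2
  -- Two numbers, each at most `tr(A + B)`, average to `tr(A + B)`; both are therefore extremal, for
  -- `Z` and for `E†(Z)`.
  have hsum : 2⁻¹ * ((A - B) * Z).trace.re + 2⁻¹ * ((A - B) * dualChannel K Z).trace.re =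
      (A.trace + B.trace).re := by
    rw [← h, ← hZ, Matrix.add_mul, Matrix.smul_mul, Matrix.smul_mul, Matrix.trace_add,
      Matrix.trace_smul, Matrix.trace_smul, trace_channel_mul, Complex.add_re]
    simp [Complex.mul_re]
  obtain ⟨r1, r2⟩ := mul_eq_of_trace_add_le hA hB hZ1 hZ2 (by linarith)
  obtain ⟨r3, r4⟩ := mul_eq_of_trace_add_le hA hB hE1 hE2 (by linarith)
  exact ⟨Z, r1, r2, r3, r4⟩

/-- The maximally mixed state on `A` with weight `p = 1`: the difference is positive with support
the whole of `A ⊗ B`, so its outcome `1` is the projection itself. -/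
theorem proj_eq_helstrom_of_isDensity [Nonempty α] (hW : Wᴴ * W = 1) {τ : Matrix β β ℂ}
    (hτ : τ.PosDef) :
    ∃ ρ ∈ subsystemCode W τ,
      helstrom (((1 : ℝ) : ℂ) • ρ - ((1 - 1 : ℝ) : ℂ) • ρ) 1 = W * Wᴴ := by
  have hd : (Matrix.trace (1 : Matrix α α ℂ)) ≠ 0 := by simp
  refine ⟨_, ⟨_, isDensity_of_trace_ne_zero .one hd, rfl⟩, ?_⟩
  set c : ℂ := (Matrix.trace (1 : Matrix α α ℂ))⁻¹ with hc
  have hc' : c = (((Fintype.card α : ℝ)⁻¹ : ℝ) : ℂ) := by simp [hc]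
  have hcpos : 0 < (Fintype.card α : ℝ)⁻¹ := by positivity
  have hH : (c • (1 : Matrix α α ℂ)).IsHermitian := by
    rw [Matrix.IsHermitian, Matrix.conjTranspose_smul, Matrix.conjTranspose_one, hc',
      Complex.star_def, Complex.conj_ofReal]
  have e : ((1 : ℝ) : ℂ) • (W * ((c • (1 : Matrix α α ℂ)) ⊗ₖ τ) * Wᴴ) -
      ((1 - 1 : ℝ) : ℂ) • (W * ((c • (1 : Matrix α α ℂ)) ⊗ₖ τ) * Wᴴ) =
      place W τ (c • (1 : Matrix α α ℂ)) := by
    rw [sub_self, Complex.ofReal_zero, zero_smul, sub_zero, Complex.ofReal_one, one_smul,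
      place_apply]
  rw [e, helstrom_place hW hτ hH]
  have h1 : c • (1 : Matrix α α ℂ) * 1 =
      1 * Matrix.diagonal fun _ : α => (((Fintype.card α : ℝ)⁻¹ : ℝ) : ℂ) := by
    rw [Matrix.mul_one, Matrix.one_mul, hc', Matrix.smul_one_eq_diagonal]
  have h2 : helstrom (c • (1 : Matrix α α ℂ)) 1 = 1 := by
    have := cfc_mul_of_mul_eq_mul_diagonal hH h1
      (fun x : ℝ => if SignType.sign x = 1 then (1 : ℝ) else 0)
    rw [Matrix.mul_one, Matrix.one_mul] at this
    rw [helstrom, this]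
    simp only [sign_pos hcpos, if_true, Complex.ofReal_one, Matrix.diagonal_one]
  rw [h2, place_one_one]
  simp

/-- Left multiplication by `1 ⊗ τ⁻¹` strips `τ` from an eigenvalue relation; it is used with `ε = 1`
and `ε = -1`. -/
theorem place_one_mul_eq (hW : Wᴴ * W = 1) {τ : Matrix β β ℂ} (hτ : τ.PosDef) {c ε : ℂ}
    (hc : c ≠ 0) {Y : Matrix α α ℂ} {X : Matrix n n ℂ}
    (h : (c • place W τ Y) * X = ε • c • place W τ Y) : place W 1 Y * X = ε • place W 1 Y := by
  have h1 : place W τ Y * X = ε • place W τ Y := by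
    rw [Matrix.smul_mul, smul_comm] at h
    exact smul_right_injective _ hc h
  have h2 : place W τ⁻¹ 1 * place W τ Y = place W 1 Y := by
    rw [place_mul_place hW, Matrix.one_mul, Matrix.nonsing_inv_mul _
      ((Matrix.isUnit_iff_isUnit_det _).mp hτ.isUnit)]
  rw [← h2, Matrix.mul_assoc, h1, Matrix.mul_smul]

theorem isInitializationFree_of_isNoiseless (hK : ∑ i, (K i)ᴴ * K i = 1) (hW : Wᴴ * W = 1)
    {ρ : Matrix n n ℂ} (hρ : ρ.PosSemidef) (hfix : channel K ρ = ρ) (hPρ : (W * Wᴴ) * ρ = ρ)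
    (hker : ∀ Y : Matrix n n ℂ, ρ * Y = 0 → (W * Wᴴ) * Y = 0)
    {τ : Matrix β β ℂ} (hτ : τ.PosDef) (hN : IsNoiseless (channel K) (subsystemCode W τ))
    (hU : IsUnconditionallyPreserved (channel K) (subsystemCode W τ)) :
    IsInitializationFree (channel K) W := by
  rcases isEmpty_or_nonempty α with hα | hα
  · exact fun _ _ => Subsingleton.elim _ _
  have hP := isHermitian_proj W
  have hP2 := proj_mul_self hW
  obtain ⟨ω, hω, hωP⟩ := proj_eq_helstrom_of_isDensity hW hτ
  obtain ⟨Q, hQ, hQ1, hQP⟩ := (hU ω (subset_convexHull ℝ _ hω) ω (subset_convexHull ℝ _ hω) 1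
    zero_le_one le_rfl).exists_dualChannel_eq 1
  rw [hωP] at hQP
  have hcomm := kraus_comm_of_dualChannel_eq hP hP2 hρ hfix hPρ hker hQ hQ1 hQP
  have hEP : dualChannel K (W * Wᴴ) = W * Wᴴ := by
    have := dualChannel_mul_of_comm hP hcomm 1
    rwa [dualChannel_one hK, Matrix.mul_one] at this
  rw [isInitializationFree_iff]
  suffices h : (dualChannel K).comp (place W 1) - place W 1 = 0 by
    intro Y
    have := LinearMap.congr_fun h Y
    simpa [sub_eq_zero] using this
  refine linearMap_eq_zero_of_proj _ fun F hF hF2 => ?_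
  rw [LinearMap.sub_apply, LinearMap.comp_apply, sub_eq_zero]
  have hFp := posSemidef_of_proj hF hF2
  have hFp' : (1 - F).PosSemidef := posSemidef_of_proj (Matrix.isHermitian_one.sub hF)
    (by simp [Matrix.sub_mul, Matrix.mul_sub, hF2])
  by_cases hr : F.trace = 0
  · rw [hFp.trace_eq_zero_iff.mp hr, map_zero, map_zero]
  by_cases hs : (1 - F).trace = 0
  -- The boundary case `F = 1`, where `1 - F` cannot be normalized, is `E†(P) = P`.
  · rw [← sub_eq_zero.mp (hFp'.trace_eq_zero_iff.mp hs), place_one_one, hEP]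
  have hFF : F * (1 - F) = 0 := by rw [Matrix.mul_sub, Matrix.mul_one, hF2, sub_self]
  have hd1 := isDensity_of_trace_ne_zero hFp hr
  have hd2 := isDensity_of_trace_ne_zero hFp' hs
  set r := (F.trace)⁻¹ with hrdef
  set s := ((1 - F).trace)⁻¹ with hsdef
  have hr0 : r ≠ 0 := inv_ne_zero hr
  have hs0 : s ≠ 0 := inv_ne_zero hs
  have h2 : (0 : ℂ) ≤ 2⁻¹ := by simp
  have hA := (posSemidef_place W hτ.posSemidef hd1.1).smul h2
  have hB := (posSemidef_place W hτ.posSemidef hd2.1).smul h2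
  have hAB : ((2⁻¹ : ℂ) • place W τ (r • F)) * ((2⁻¹ : ℂ) • place W τ (s • (1 - F))) = 0 := by
    rw [Matrix.smul_mul, Matrix.mul_smul, place_mul_place hW, Matrix.smul_mul, Matrix.mul_smul, hFF]
    simp
  -- The equal mixture of `E ^ 0` and `E ^ 1`, at equal prior weights.
  have hnorm := hN {0, 1} (fun _ => 2⁻¹) (fun _ _ => by norm_num) (by norm_num)
    (place W τ (r • F)) ⟨_, hd1, rfl⟩ (place W τ (s • (1 - F))) ⟨_, hd2, rfl⟩ 2⁻¹
    (by norm_num) (by norm_num)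
  rw [show (1 - 2⁻¹ : ℝ) = 2⁻¹ by norm_num, Finset.sum_pair zero_ne_one,
    LinearMap.add_apply, LinearMap.smul_apply, LinearMap.smul_apply, pow_zero, pow_one,
    Module.End.one_apply, Complex.ofReal_inv, Complex.ofReal_ofNat] at hnorm
  obtain ⟨Z, z1, z2, z3, z4⟩ := exists_sign_of_traceNorm_average hK hA hB hAB hnorm
  rw [map_smul, smul_smul] at z1 z2 z3 z4
  rw [← neg_one_smul ℂ] at z2 z4
  have h2' : (2⁻¹ : ℂ) ≠ 0 := by norm_num
  have hsign : ∀ X : Matrix n n ℂ, ((2⁻¹ * r) • place W τ F) * X = (2⁻¹ * r) • place W τ F →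
      ((2⁻¹ * s) • place W τ (1 - F)) * X = (-1 : ℂ) • (2⁻¹ * s) • place W τ (1 - F) →
      W * Wᴴ * X = place W 1 (F - (1 - F)) := by
    intro X h1 h2
    have e1 := place_one_mul_eq hW hτ (mul_ne_zero h2' hr0) (ε := 1) (by rw [one_smul]; exact h1)
    have e2 := place_one_mul_eq hW hτ (mul_ne_zero h2' hs0) h2
    calc W * Wᴴ * X = place W 1 F * X + place W 1 (1 - F) * X := by
          rw [← Matrix.add_mul, ← map_add, add_sub_cancel, place_one_one]
      _ = _ := by rw [e1, e2, map_sub _ F, one_smul, neg_one_smul, ← sub_eq_add_neg]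
  have f1 := hsign Z z1 z2
  have f2 := hsign _ z3 z4
  -- `P * E†(Z) = E†(P * Z)`, so `E†` fixes `(2F - 1) ⊗ 1`.
  rw [← dualChannel_mul_of_comm hP hcomm, f1] at f2
  have f3 : dualChannel K (place W 1 1) = place W 1 1 := by rw [place_one_one, hEP]
  have f4 : F = (2⁻¹ : ℂ) • ((F - (1 - F)) + 1) := by
    rw [show (F - (1 - F)) + 1 = (2 : ℂ) • F by rw [two_smul]; abel, smul_smul]
    norm_num
  rw [f4, map_smul, map_smul, map_add, map_add, f2, f3]

end Characterization
-- Full rank of fixed codes, and interference terms.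
section FixedCode

set_option linter.unusedSectionVars false

variable {n ι κ : Type*} [Fintype n] [DecidableEq n] [Fintype ι] [Fintype κ]
  {a b : κ → Type*} [∀ k, Fintype (a k)] [∀ k, DecidableEq (a k)]
  [∀ k, Fintype (b k)] [∀ k, DecidableEq (b k)]
  {K : ι → Matrix n n ℂ} {V : ∀ k, Matrix n (a k × b k) ℂ}

theorem IsSectorDecomposition.exists_eq_kronecker_one (hV : IsSectorDecomposition K V) (k : κ)
    (S : Matrix (b k) (b k) ℂ)
    (h : totalProj V * dualChannel K (place (V k) S 1) * totalProj V = place (V k) S 1) :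
    ∃ Y : Matrix (a k) (a k) ℂ, (1 : Matrix (a k) (a k) ℂ) ⊗ₖ S = Y ⊗ₖ (1 : Matrix (b k) (b k) ℂ) := by
  obtain ⟨Y, hY⟩ := (hV.algebra (place (V k) S 1)).mp ⟨by
    rw [place_apply, ← Matrix.mul_assoc, ← Matrix.mul_assoc, hV.totalProj_mul_isometry,
      Matrix.mul_assoc, hV.isometry_mul_totalProj], h⟩
  refine ⟨Y k, ?_⟩
  have h1 := congrArg (fun X => (V k)ᴴ * X * V k) hY
  have h2 : ∀ M : Matrix (a k × b k) (a k × b k) ℂ, (V k)ᴴ * (V k * M * (V k)ᴴ) * V k = M := by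
    intro M
    calc _ = ((V k)ᴴ * V k) * M * ((V k)ᴴ * V k) := by simp only [Matrix.mul_assoc]
      _ = M := by rw [hV.isometry, Matrix.one_mul, Matrix.mul_one]
  rw [place_apply, h2, Matrix.mul_sum, Matrix.sum_mul, Finset.sum_eq_single k, h2] at h1
  · exact h1
  · intro l _ hl
    rw [← Matrix.mul_assoc, ← Matrix.mul_assoc, hV.orthogonal k l hl.symm]
    simp
  · simp

/-- A state on `B_k` all of whose products with states on `A_k` are fixed has full rank. -/
theorem IsSectorDecomposition.posDef_of_fixed (hV : IsSectorDecomposition K V)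
    (hK : ∑ i, (K i)ᴴ * K i = 1) (k : κ) [Nonempty (a k)] {τ : Matrix (b k) (b k) ℂ}
    (hτ : IsDensity τ) (hfix : ∀ ρ ∈ subsystemCode (V k) τ, channel K ρ = ρ) : τ.PosDef := by
  have hW := hV.isometry k
  obtain ⟨S, N, hS, hS2, hSτ, hτN⟩ := exists_support_proj hτ.1.1
  have hNτ : Nᴴ * τ = S := by
    simpa [hτ.1.1.eq, hS.eq] using congrArg Matrix.conjTranspose hτN
  have hd : (Matrix.trace (1 : Matrix (a k) (a k) ℂ)) ≠ 0 := by simp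
  have hρfix : channel K (place (V k) τ 1) = place (V k) τ 1 := by
    have := hfix _ ⟨_, isDensity_of_trace_ne_zero .one hd, rfl⟩
    rw [← place_apply, map_smul, map_smul] at this
    exact smul_right_injective _ (inv_ne_zero hd) this
  have hρ := posSemidef_place (V k) hτ.1 (.one (n := a k))
  set R := place (V k) S 1 with hRdef
  have hR : R.IsHermitian := by
    rw [Matrix.IsHermitian, hRdef, place_conjTranspose, hS.eq, Matrix.conjTranspose_one]
  have hR2 : R * R = R := by rw [hRdef, place_mul_place hW, hS2, Matrix.one_mul]
  have hRρ : R * place (V k) τ 1 = place (V k) τ 1 := by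
    rw [hRdef, place_mul_place hW, hSτ, Matrix.one_mul]
  have hker : ∀ Y : Matrix n n ℂ, place (V k) τ 1 * Y = 0 → R * Y = 0 := by
    intro Y hY
    have e : R = place (V k) Nᴴ 1 * place (V k) τ 1 := by
      rw [place_mul_place hW, hNτ, Matrix.one_mul]
    rw [e, Matrix.mul_assoc, hY, Matrix.mul_zero]
  have e1 := mul_dualChannel_of_invariant hK hR (kraus_mul_support hρ hρfix hR hR2 hRρ hker)
  have hE : (dualChannel K R).PosSemidef := posSemidef_dualChannel K (posSemidef_of_proj hR hR2)
  have e1' : dualChannel K R * R = R := by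
    simpa [hE.1.eq, hR.eq] using congrArg Matrix.conjTranspose e1
  have hP0 := isHermitian_totalProj V
  have hP0R : totalProj V * R = R := by
    rw [hRdef, place_apply, ← Matrix.mul_assoc, ← Matrix.mul_assoc, hV.totalProj_mul_isometry]
  have hRP0 : R * totalProj V = R := by
    simpa [hP0.eq, hR.eq] using congrArg Matrix.conjTranspose hP0R
  have hP00 := hV.totalProj_mul_self
  obtain ⟨ρ₀, h1, h2, h3, h4⟩ := hV.exists_fixed hK
  have h3' : ρ₀ * totalProj V = ρ₀ := by
    simpa [h1.1.eq, hP0.eq] using congrArg Matrix.conjTranspose h3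
  -- By `R * E†(R) = R` the off-diagonal blocks drop out, and this difference is the compression of
  -- `E†(R) ≥ 0` to `P₀ - R`.
  have hX : (totalProj V * dualChannel K R * totalProj V - R).PosSemidef := by
    have := hE.conjTranspose_mul_mul_same (totalProj V - R)
    rw [(hP0.sub hR).eq] at this
    convert this using 1
    rw [Matrix.sub_mul, Matrix.mul_sub, Matrix.sub_mul, e1, Matrix.sub_mul]
    rw [Matrix.mul_assoc _ _ R, e1', hP0R, hR2, hRP0]
    simp
  -- The fixed `ρ₀` gives the difference zero expectation, and `ρ₀` is faithful on `P₀`; hence `R`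
  -- is a fixed point of the compressed dual map.
  have htr : (ρ₀ * (totalProj V * dualChannel K R * totalProj V - R)).trace = 0 := by
    rw [Matrix.mul_sub, Matrix.trace_sub, ← Matrix.mul_assoc, Matrix.trace_mul_comm,
      ← Matrix.mul_assoc, ← Matrix.mul_assoc, h3, h3', ← trace_channel_mul, h2, sub_self]
  have hX0 := h4 _ (PosSemidef.mul_eq_zero_of_trace h1 hX htr)
  rw [Matrix.mul_sub, ← Matrix.mul_assoc, ← Matrix.mul_assoc, hP00, hP0R, sub_eq_zero] at hX0
  obtain ⟨Y, hY⟩ := hV.exists_eq_kronecker_one k S hX0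
  obtain ⟨i⟩ := ‹Nonempty (a k)›
  -- `1 ⊗ S = Y ⊗ 1`, read on a diagonal block, makes `S` scalar; `S * τ = τ` with `tr τ = 1` makes
  -- the scalar `1`.
  have hSc : S = (Y i i) • (1 : Matrix (b k) (b k) ℂ) := by
    ext j j'
    have := congrFun (congrFun hY (i, j)) (i, j')
    simpa [Matrix.kroneckerMap_apply] using this
  have hτc : (Y i i) • τ = τ := by
    rw [← Matrix.one_mul τ, ← Matrix.smul_mul, ← hSc, hSτ, Matrix.one_mul]
  have hc : Y i i = 1 := by
    have := congrArg Matrix.trace hτc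
    rwa [Matrix.trace_smul, hτ.2, smul_eq_mul, mul_one] at this
  rw [hc, one_smul] at hSc
  rw [hτ.1.posDef_iff_isUnit]
  exact IsUnit.of_mul_eq_one _ (hτN.trans hSc)

/-! ### Interference -/

theorem interference_eq_zero_iff (K : ι → Matrix n n ℂ) (P : Matrix n n ℂ) {P₀ : Matrix n n ℂ}
    (h0 : P₀.IsHermitian) (h00 : P₀ * P₀ = P₀) :
    (∀ ρ, IsDensity ρ → interference K P P₀ ρ = 0) ↔ ∀ i, P * K i * (1 - P₀) = 0 := by
  constructor
  · intro h i
    let L : Matrix n n ℂ →ₗ[ℂ] Matrix n n ℂ :=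
      { toFun := interference K P P₀
        map_add' := fun X Y => by
          simp only [interference, Matrix.mul_add, Matrix.add_mul, Finset.sum_add_distrib]
          abel
        map_smul' := fun c X => by
          simp only [interference, Matrix.mul_smul, Matrix.smul_mul, Finset.smul_sum, smul_add,
            RingHom.id_apply] }
    -- States span, so the identity may be inserted; the cross terms then vanish because `P₀ * (1 -
    -- P₀) = 0`.
    have h1 : interference K P P₀ 1 = 0 :=
      LinearMap.congr_fun (linearMap_eq_zero_of_isDensity L h) 1
    have e1 : ∀ i, P * K i * P₀ * (P * K i * (1 - P₀))ᴴ = 0 := by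
      intro i
      have : P₀ * (1 - P₀)ᴴ = 0 := by
        rw [(Matrix.isHermitian_one.sub h0).eq, Matrix.mul_sub, Matrix.mul_one, h00, sub_self]
      rw [Matrix.conjTranspose_mul _ (1 - P₀), ← Matrix.mul_assoc, Matrix.mul_assoc (P * K i), this,
        Matrix.mul_zero, Matrix.zero_mul]
    have e2 : ∀ i, P * K i * (1 - P₀) * (P * K i * P₀)ᴴ = 0 := by
      intro i
      rw [← Matrix.conjTranspose_eq_zero, Matrix.conjTranspose_mul,
        Matrix.conjTranspose_conjTranspose, e1]
    simp only [interference, Matrix.mul_one, e1, e2, add_zero, Finset.sum_const_zero] at h1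
    have h2 := eq_zero_of_sum_conjTranspose_mul_self (M := fun i => (P * K i * (1 - P₀))ᴴ)
      (by simpa only [Matrix.conjTranspose_conjTranspose] using h1) i
    exact Matrix.conjTranspose_eq_zero.mp h2
  · intro h ρ _
    simp [interference, h]

/-- `E†(P) = P` gives `P * K i = P * K i * P`, and `P ≤ P₀`. Conversely, vanishing blocks mean that
`E†(Y ⊗ 1)` already lives on `P₀`, where the sector algebra fixes it. -/
theorem IsSectorDecomposition.isInitializationFree_iff (hV : IsSectorDecomposition K V)
    (k : κ) :
    IsInitializationFree (channel K) (V k) ↔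
      ∀ i, V k * (V k)ᴴ * K i * (1 - totalProj V) = 0 := by
  have hW := hV.isometry k
  have hP := isHermitian_proj (V k)
  have hP2 := proj_mul_self hW
  rw [NoiselessSubsystem.isInitializationFree_iff]
  constructor
  · intro h i
    have h1 := h 1
    rw [place_one_one] at h1
    rw [← mul_kraus_comm_of_dualChannel_fixed hP hP2 h1 i, Matrix.mul_assoc _ _ (1 - _),
      Matrix.mul_sub, Matrix.mul_one, Matrix.mul_assoc (V k) _ (totalProj V),
      hV.isometry_mul_totalProj, sub_self, Matrix.mul_zero]
  · intro h Y
    have e1 : ∀ i, (V k)ᴴ * K i * totalProj V = (V k)ᴴ * K i := by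
      intro i
      have := congrArg ((V k)ᴴ * ·) (h i)
      simp only [← Matrix.mul_assoc, hW, Matrix.one_mul, Matrix.mul_zero] at this
      rw [Matrix.mul_sub, Matrix.mul_one, sub_eq_zero] at this
      exact this.symm
    have e2 : ∀ i, totalProj V * (K i)ᴴ * V k = (K i)ᴴ * V k := by
      intro i
      simpa [(isHermitian_totalProj V).eq, Matrix.mul_assoc] using
        congrArg Matrix.conjTranspose (e1 i)
    have e3 := hV.compress_dualChannel k Y
    rw [← place_apply] at e3
    rw [← e3]
    conv_lhs => rw [e3]
    rw [dualChannel_apply, Matrix.mul_sum, Matrix.sum_mul]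
    refine Finset.sum_congr rfl fun i _ => ?_
    calc (K i)ᴴ * place (V k) 1 Y * K i
        = ((K i)ᴴ * V k) * (Y ⊗ₖ (1 : Matrix (b k) (b k) ℂ)) * ((V k)ᴴ * K i) := by
          rw [place_apply]; simp only [Matrix.mul_assoc]
      _ = (totalProj V * (K i)ᴴ * V k) * (Y ⊗ₖ (1 : Matrix (b k) (b k) ℂ)) *
          ((V k)ᴴ * K i * totalProj V) := by rw [e1, e2]
      _ = _ := by rw [place_apply]; simp only [Matrix.mul_assoc]

/-- The converse uses only that `W * Wᴴ` is the support of a fixed positive operator, so any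
factorization of the sector is admissible. -/
theorem IsSectorDecomposition.isInitializationFree_iff_isNoiseless
    (hV : IsSectorDecomposition K V) (hK : ∑ i, (K i)ᴴ * K i = 1) (k : κ)
    {α β : Type*} [Fintype α] [DecidableEq α] [Fintype β] [DecidableEq β]
    {W : Matrix n (α × β) ℂ} (hW : Wᴴ * W = 1) (hWk : W * Wᴴ = V k * (V k)ᴴ)
    {τ : Matrix β β ℂ} (hτ : τ.PosDef) :
    IsInitializationFree (channel K) W ↔ IsNoiseless (channel K) (subsystemCode W τ) ∧
      IsUnconditionallyPreserved (channel K) (subsystemCode W τ) := by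
  obtain ⟨ρ, h1, h2, h3, h4⟩ := hV.exists_fixed_sector hK k
  rw [← hWk] at h3 h4
  exact ⟨fun h => ⟨isNoiseless_of_isInitializationFree hK hW hτ.posSemidef h,
    isUnconditionallyPreserved_of_isInitializationFree hK hW hτ h⟩,
    fun h => isInitializationFree_of_isNoiseless hK hW h1 h2 h3 h4 hτ h.1 h.2⟩

theorem subsystemCode_eq_empty {α β : Type*} [Fintype α] [IsEmpty α] [Fintype β]
    (W : Matrix n (α × β) ℂ) (τ : Matrix β β ℂ) : subsystemCode W τ = ∅ := by
  refine Set.eq_empty_of_forall_notMem ?_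
  rintro _ ⟨ρ, hρ, -⟩
  simpa [Matrix.trace] using hρ.2

end FixedCode

end NoiselessSubsystem

theorem mainTheorem10 {n ι κ : Type*} [Fintype n] [DecidableEq n] [Fintype ι] [Fintype κ]
    {a b : κ → Type*} [∀ k, Fintype (a k)] [∀ k, DecidableEq (a k)]
    [∀ k, Fintype (b k)] [∀ k, DecidableEq (b k)]
    (K : ι → Matrix n n ℂ) (hK : ∑ i, (K i)ᴴ * K i = 1)
    (V : ∀ k, Matrix n (a k × b k) ℂ)
    (hV : NoiselessSubsystem.IsSectorDecomposition K V) (k : κ)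
    {α β : Type*} [Fintype α] [DecidableEq α] [Fintype β] [DecidableEq β]
    (W : Matrix n (α × β) ℂ) (hW : Wᴴ * W = 1) (hWk : W * Wᴴ = V k * (V k)ᴴ) :
    -- the noiseless subsystem `A_k` of the sector, with its code of fixed states `ρ ⊗ τ`
    (∀ τ : Matrix (b k) (b k) ℂ, NoiselessSubsystem.IsDensity τ →
      (∀ ρ ∈ NoiselessSubsystem.subsystemCode (V k) τ, NoiselessSubsystem.channel K ρ = ρ) →
      (NoiselessSubsystem.IsInitializationFree (NoiselessSubsystem.channel K) (V k) ↔
        NoiselessSubsystem.IsNoiseless (NoiselessSubsystem.channel K)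
            (NoiselessSubsystem.subsystemCode (V k) τ) ∧
          NoiselessSubsystem.IsUnconditionallyPreserved (NoiselessSubsystem.channel K)
            (NoiselessSubsystem.subsystemCode (V k) τ))) ∧
    -- an arbitrary subsystem `A` whose support `A ⊗ B` is the sector, with a full-rank state on `B`
    (∀ τ : Matrix β β ℂ, NoiselessSubsystem.IsDensity τ → τ.PosDef →
      (NoiselessSubsystem.IsInitializationFree (NoiselessSubsystem.channel K) W ↔
        NoiselessSubsystem.IsNoiseless (NoiselessSubsystem.channel K)
            (NoiselessSubsystem.subsystemCode W τ) ∧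
          NoiselessSubsystem.IsUnconditionallyPreserved (NoiselessSubsystem.channel K)
            (NoiselessSubsystem.subsystemCode W τ))) ∧
    -- `A_k` is initialization-free iff the interference terms vanish
    (NoiselessSubsystem.IsInitializationFree (NoiselessSubsystem.channel K) (V k) ↔
      ∀ ρ, NoiselessSubsystem.IsDensity ρ →
        NoiselessSubsystem.interference K (V k * (V k)ᴴ) (NoiselessSubsystem.totalProj V) ρ = 0) ∧
    -- the interference terms vanish iff the blocks `D_i` are zero
    ((∀ ρ, NoiselessSubsystem.IsDensity ρ →
        NoiselessSubsystem.interference K (V k * (V k)ᴴ) (NoiselessSubsystem.totalProj V) ρ = 0) ↔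
      ∀ i, V k * (V k)ᴴ * K i * (1 - NoiselessSubsystem.totalProj V) = 0) := by
  refine ⟨fun τ hτ hfix => ?_, fun τ _ hτ => ?_, ?_, ?_⟩
  -- For empty `A_k` the code is empty and `hfix` says nothing about the rank of `τ`, but both sides
  -- hold trivially.
  · rcases isEmpty_or_nonempty (a k) with ha | ha
    · rw [NoiselessSubsystem.subsystemCode_eq_empty]
      refine iff_of_true (fun _ _ => Subsingleton.elim _ _) ⟨?_, ?_⟩
      · intro _ _ _ _ ρ hρ
        exact hρ.elim
      · intro ρ hρ
        simp at hρ
    · exact hV.isInitializationFree_iff_isNoiseless hK k (hV.isometry k) rfl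
        (hV.posDef_of_fixed hK k hτ hfix)
  · exact hV.isInitializationFree_iff_isNoiseless hK k hW hWk hτ
  · rw [NoiselessSubsystem.interference_eq_zero_iff K _
      (NoiselessSubsystem.isHermitian_totalProj V) hV.totalProj_mul_self]
    exact hV.isInitializationFree_iff k
  · exact NoiselessSubsystem.interference_eq_zero_iff K _
      (NoiselessSubsystem.isHermitian_totalProj V) hV.totalProj_mul_self
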